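/- Let $E$ be a finite set, let $S=\mathbb{C}[x_e]_{e\in E}$, and let $I\subset S$ be an ideal that is homogeneous with respect to the standard grading. For $w\in\mathbb{R}^E$ let $\operatorname{in}_w I$ be the initial ideal, generated by the initial forms $\operatorname{in}_w p$, $p\in I$, where $\operatorname{in}_w p$ is the sum of the terms of $p$ of least $w$-weight. Let $\mathcal L(I)=\{w\in\mathbb{R}^E : \operatorname{in}_w I=I\}$, a linear subspace of $\mathbb{R}^E$, and let $\mathcal A(I)=(a_e)_{e\in E}$ be the point configuration in $\mathcal L(I)^*$ where $a_e$ is the restriction to $\mathcal L(I)$ of the $e$-th coordinate function. For $w\in\mathbb{R}^E$ the regular subdivision $\operatorname{subd}_w\mathcal A(I)$ is the set of all cells, i.e. of all subsets $\Delta\subset E$ of the form $\Delta=\{e : f(a_e)+w_e\le f(a_{e'})+w_{e'}\text{ for all }e'\in E\}$ with $f$ a linear functional on $\mathcal L(I)^*$. The secondary fan $\operatorname{Sec}\mathcal A(I)$ is the polyhedral fan in $\mathbb{R}^E$ whose cones are the closures of the sets $\{w : \operatorname{subd}_w\mathcal A(I)=\Theta\}$, where $\Theta$ ranges over all regular subdivisions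 of $\mathcal A(I)$; $-\operatorname{Sec}\mathcal A(I)$ is its reflection in the origin. For $\Delta\subset E$ let $\mathbb{C}[\Delta]=\mathbb{C}[x_e]_{e\in\Delta}\subset S$ and let $\rho_\Delta\colon S\to\mathbb{C}[\Delta]$ be the homomorphism that fixes $x_e$ for $e\in\Delta$ and takes the other variables to $0$. For $w\in\mathbb{R}^E$ let $I_w\subset S$ be the sum, over all cells $\Delta$ of $\operatorname{subd}_w\mathcal A(I)$, of the ideals of $S$ generated by $\rho_\Delta(I)$, and let $I^w\subset S$ be the intersection, over all cells $\Delta$ of $\operatorname{subd}_{-w}\mathcal A(I)$, of the ideals of $S$ generated by $I\cap\mathbb{C}[\Delta]$ and all $x_e$ with $e\notin\Delta$. Then the set $\Omega(I)=\{w\in\mathbb{R}^E : I_w=\operatorname{in}_w I\}$ is the support of a subfan of $\operatorname{Sec}\mathcal A(I)$, and the set $\Omega^*(I)=\{w\in\mathbb{R}^E : I^w=\operatorname{in}_w I\}$ is the support of a subfan of $-\operatorname{Sec}\mathcal A(I)$. -/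

import Mathlib

open scoped Pointwise

namespace InitialDegeneration

noncomputable section

/-! ### Initial ideals -/

/-- The initial form of `p` with respect to the weight `w`: the homogeneous component of `p` of the
least weight that occurs in `p`. (For `p = 0` it is `0`.) -/
def initialForm {E : Type*} (w : E → ℝ) (p : MvPolynomial E ℂ) : MvPolynomial E ℂ :=
  MvPolynomial.weightedHomogeneousComponent w
    (sInf (Finsupp.weight w '' (p.support : Set (E →₀ ℕ)))) p

/-- The initial ideal `in_w I`. -/
def initialIdeal {E : Type*} (w : E → ℝ) (I : Ideal (MvPolynomial E ℂ)) :
    Ideal (MvPolynomial E ℂ) :=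
  Ideal.span (initialForm w '' (I : Set (MvPolynomial E ℂ)))

/-- `in_w I = I` holds exactly when `I` is homogeneous with respect to the grading `w`. -/
theorem initialIdeal_eq_self_iff {E : Type*} (w : E → ℝ) (I : Ideal (MvPolynomial E ℂ)) :
    initialIdeal w I = I ↔
      ∀ p ∈ I, ∀ c : ℝ, MvPolynomial.weightedHomogeneousComponent w c p ∈ I := by
  classical
  constructor
  · intro h
    have hin : ∀ p ∈ I, initialForm w p ∈ I := fun p hp => by
      have : initialForm w p ∈ initialIdeal w I := Ideal.subset_span ⟨p, hp, rfl⟩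
      rwa [h] at this
    suffices H : ∀ n : ℕ, ∀ p ∈ I, p.support.card = n → ∀ c : ℝ,
        MvPolynomial.weightedHomogeneousComponent w c p ∈ I from
      fun p hp c => H _ p hp rfl c
    intro n
    induction n using Nat.strong_induction_on with
    | _ n ih =>
      intro p hp hn c
      by_cases h0 : p = 0
      · subst h0
        simp
      have hne : (Finsupp.weight w '' (p.support : Set (E →₀ ℕ))).Nonempty := by
        obtain ⟨d, hd⟩ := MvPolynomial.support_nonempty.mpr h0
        exact ⟨_, d, hd, rfl⟩
      obtain ⟨d, hd, hdw⟩ := hne.csInf_mem ((Finset.finite_toSet _).image _)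
      set m := sInf (Finsupp.weight w '' (p.support : Set (E →₀ ℕ))) with hm
      have hq : MvPolynomial.weightedHomogeneousComponent w m p ∈ I := hin p hp
      set q := MvPolynomial.weightedHomogeneousComponent w m p with hqdef
      have hcq : ∀ a, MvPolynomial.coeff a q
          = if Finsupp.weight w a = m then MvPolynomial.coeff a p else 0 := fun a =>
        MvPolynomial.coeff_weightedHomogeneousComponent m p a
      have hlt : (p - q).support.card < n := by
        rw [← hn]
        apply Finset.card_lt_card
        rw [Finset.ssubset_iff_of_subset]
        · refine ⟨d, hd, ?_⟩
          simp [MvPolynomial.mem_support_iff, hcq, hdw]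
        · intro a ha
          rw [MvPolynomial.mem_support_iff, MvPolynomial.coeff_sub, hcq] at ha
          rw [MvPolynomial.mem_support_iff]
          intro h'
          simp [h'] at ha
      have h1 := ih _ hlt (p - q) (I.sub_mem hp hq) rfl c
      have h2 : MvPolynomial.weightedHomogeneousComponent w c q ∈ I := by
        by_cases hc : c = m
        · have : MvPolynomial.weightedHomogeneousComponent w c q = q := by
            ext a
            rw [MvPolynomial.coeff_weightedHomogeneousComponent, hcq, hc]
            split_ifs <;> rfl
          rw [this]
          exact hq
        · have : MvPolynomial.weightedHomogeneousComponent w c q = 0 := by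
            ext a
            rw [MvPolynomial.coeff_weightedHomogeneousComponent, hcq]
            split_ifs with h3 h4
            · exact absurd (h3.symm.trans h4) hc
            · simp
            · simp
          rw [this]
          exact I.zero_mem
      have h3 := I.add_mem h1 h2
      rwa [← map_add, sub_add_cancel] at h3
  · intro h
    apply le_antisymm
    · rw [initialIdeal, Ideal.span_le]
      rintro _ ⟨p, hp, rfl⟩
      exact h p hp _
    · intro p hp
      have hc : ∀ c : ℝ, MvPolynomial.weightedHomogeneousComponent w c p ∈ initialIdeal w I := by
        intro c
        by_cases h0 : MvPolynomial.weightedHomogeneousComponent w c p = 0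
        · rw [h0]
          exact Ideal.zero_mem _
        set q := MvPolynomial.weightedHomogeneousComponent w c p with hqdef
        have hcq : ∀ a, MvPolynomial.coeff a q
            = if Finsupp.weight w a = c then MvPolynomial.coeff a p else 0 := fun a =>
          MvPolynomial.coeff_weightedHomogeneousComponent c p a
        have hne : (q.support : Set (E →₀ ℕ)).Nonempty :=
          MvPolynomial.support_nonempty.mpr h0
        have himg : Finsupp.weight w '' (q.support : Set (E →₀ ℕ)) = {c} := by
          refine (hne.image _).subset_singleton_iff.mp ?_
          rintro _ ⟨a, ha, rfl⟩
          have ha' : MvPolynomial.coeff a q ≠ 0 := MvPolynomial.mem_support_iff.mp ha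
          rw [hcq] at ha'
          by_contra hcon
          exact ha' (if_neg hcon)
        have hself : initialForm w q = q := by
          rw [initialForm, himg, csInf_singleton]
          ext a
          rw [MvPolynomial.coeff_weightedHomogeneousComponent, hcq]
          split_ifs <;> rfl
        have hmem : initialForm w q ∈ initialIdeal w I := Ideal.subset_span ⟨q, h p hp c, rfl⟩
        rwa [hself] at hmem
      rw [← MvPolynomial.sum_weightedHomogeneousComponent w p]
      rw [finsum_eq_sum _ (MvPolynomial.weightedHomogeneousComponent_finsupp p)]
      exact Ideal.sum_mem _ fun c _ => hc c

/-- The lineality space `L(I)` of the Gröbner fan: all weights `w` with `in_w I = I`. -/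
def linealitySpace {E : Type*} (I : Ideal (MvPolynomial E ℂ)) : Submodule ℝ (E → ℝ) where
  carrier := {w | initialIdeal w I = I}
  zero_mem' := by
    classical
    rw [Set.mem_ofPred_eq, initialIdeal_eq_self_iff]
    intro p hp c
    rw [MvPolynomial.weightedHomogeneousComponent_apply]
    have h0 : ∀ d : E →₀ ℕ, Finsupp.weight (0 : E → ℝ) d = 0 := fun d => by
      simp [Finsupp.weight_apply]
    by_cases hc : (0 : ℝ) = c
    · simpa [h0, hc, MvPolynomial.support_sum_monomial_coeff] using hp
    · simp [h0, hc]
  add_mem' := by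
    classical
    intro w w' hw hw'
    rw [Set.mem_ofPred_eq, initialIdeal_eq_self_iff] at *
    intro p hp c
    have hadd : ∀ d : E →₀ ℕ,
        Finsupp.weight (w + w') d = Finsupp.weight w d + Finsupp.weight w' d := fun d => by
      simp [Finsupp.weight_apply, Finsupp.sum, Finset.sum_add_distrib]
    have hsum : MvPolynomial.weightedHomogeneousComponent (w + w') c p
        = ∑ b ∈ p.support.image (Finsupp.weight w),
          MvPolynomial.weightedHomogeneousComponent w' (c - b)
            (MvPolynomial.weightedHomogeneousComponent w b p) := by
      ext a
      simp only [MvPolynomial.coeff_sum, MvPolynomial.coeff_weightedHomogeneousComponent, hadd]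
      by_cases ha : a ∈ p.support
      · rw [Finset.sum_eq_single (Finsupp.weight w a)]
        · simp [eq_sub_iff_add_eq, add_comm]
        · intro b _ hb
          simp [Ne.symm hb]
        · intro hcon
          exact absurd (Finset.mem_image_of_mem _ ha) hcon
      · simp [MvPolynomial.notMem_support_iff.mp ha]
    rw [hsum]
    exact Ideal.sum_mem _ fun b _ => hw' _ (hw p hp b) _
  smul_mem' := by
    classical
    intro k w hw
    rw [Set.mem_ofPred_eq, initialIdeal_eq_self_iff] at *
    intro p hp c
    have hsm : ∀ d : E →₀ ℕ, Finsupp.weight (k • w) d = k * Finsupp.weight w d := fun d => by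
      simp [Finsupp.weight_apply, Finsupp.sum, Finset.mul_sum, mul_left_comm]
    rw [MvPolynomial.weightedHomogeneousComponent_apply]
    by_cases hk : k = 0
    · have h0 : ∀ d : E →₀ ℕ, Finsupp.weight (k • w) d = 0 := fun d => by
        rw [hsm, hk, zero_mul]
      simp only [h0]
      by_cases hc : (0 : ℝ) = c
      · simpa [hc, MvPolynomial.support_sum_monomial_coeff] using hp
      · simp [hc]
    · have hkc : ∀ d : E →₀ ℕ, Finsupp.weight (k • w) d = c ↔ Finsupp.weight w d = c / k :=
        fun d => by rw [hsm, eq_div_iff hk, mul_comm]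
      simp only [hkc]
      rw [← MvPolynomial.weightedHomogeneousComponent_apply]
      exact hw p hp _

/-! ### Point configurations and regular subdivisions

A point subconfiguration of an `E`-labeled configuration `a : E → V` is recorded by its set of
labels, a subset of `E`. -/

/-- The point configuration `(u_e|_L)` in the dual of a subspace `L` of `ℝ^E`, where `u_e` is the
`e`-th coordinate function. -/
def configOfSubspace {E : Type*} (L : Submodule ℝ (E → ℝ)) : E → Module.Dual ℝ L :=
  fun e => (LinearMap.proj e : (E → ℝ) →ₗ[ℝ] ℝ).domRestrict L

/-- The point configuration `A(I)` associated with an ideal. -/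
def configOfIdeal {E : Type*} (I : Ideal (MvPolynomial E ℂ)) :
    E → Module.Dual ℝ (linealitySpace I) :=
  configOfSubspace (linealitySpace I)

/-- The (labels of the) face of a configuration on which a linear functional is minimal. -/
def face {E V : Type*} [AddCommGroup V] [Module ℝ V] (a : E → V) (f : Module.Dual ℝ V) : Set E :=
  {e' | ∀ e, f (a e') ≤ f (a e)}

/-- The lifted configuration in `V ⊕ ℝ`. -/
def lift {E V : Type*} (a : E → V) (w : E → ℝ) : E → V × ℝ :=
  fun e => (a e, w e)

/-- The regular subdivision of `a` induced by `w`: the set of all cells, which are the projections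
of the lower faces of the lifted configuration. -/
def regularSubdivision {E V : Type*} [AddCommGroup V] [Module ℝ V] (a : E → V) (w : E → ℝ) :
    Set (Set E) :=
  {Δ | ∃ f : Module.Dual ℝ V, Δ = face (lift a w) (f.coprod (LinearMap.id : ℝ →ₗ[ℝ] ℝ))}

/-- The closed cone of all weights in the closure of those inducing the subdivision `Θ`. -/
def secondaryCone {E V : Type*} [AddCommGroup V] [Module ℝ V] (a : E → V) (Θ : Set (Set E)) :
    Set (E → ℝ) :=
  closure {w | regularSubdivision a w = Θ}

/-- The secondary fan of `a`, as the collection of its cones. -/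
def secondaryFan {E V : Type*} [AddCommGroup V] [Module ℝ V] (a : E → V) :
    Set (Set (E → ℝ)) :=
  {σ | ∃ w : E → ℝ, σ = secondaryCone a (regularSubdivision a w)}

/-! ### Polyhedral fans -/

/-- A polyhedral cone: an intersection of finitely many closed linear half-spaces. -/
def IsPolyhedralCone {V : Type*} [AddCommGroup V] [Module ℝ V] (σ : Set V) : Prop :=
  ∃ C : PointedCone ℝ V,
    C.DualFG (LinearMap.id : Module.Dual ℝ V →ₗ[ℝ] Module.Dual ℝ V) ∧ (C : Set V) = σ

/-- `τ` is a face of the cone `σ`. -/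
def IsFaceOfCone {V : Type*} [AddCommGroup V] [Module ℝ V] (τ σ : Set V) : Prop :=
  ∃ T C : PointedCone ℝ V, T.IsFaceOf C ∧ (T : Set V) = τ ∧ (C : Set V) = σ

/-- A polyhedral fan: a finite collection of polyhedral cones that contains every face of each of
its members, and in which any two members intersect in a common face. -/
structure IsPolyhedralFan {V : Type*} [AddCommGroup V] [Module ℝ V] (F : Set (Set V)) : Prop where
  finite : F.Finite
  polyhedral : ∀ σ ∈ F, IsPolyhedralCone σ
  face_mem : ∀ σ ∈ F, ∀ τ, IsFaceOfCone τ σ → τ ∈ F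
  inter_face : ∀ σ ∈ F, ∀ τ ∈ F, IsFaceOfCone (σ ∩ τ) σ ∧ IsFaceOfCone (σ ∩ τ) τ

/-- `G` is a subfan of the fan `F`. -/
structure IsSubfan {V : Type*} [AddCommGroup V] [Module ℝ V] (G F : Set (Set V)) : Prop where
  fan : IsPolyhedralFan F
  subfan : IsPolyhedralFan G
  subset : G ⊆ F

/-- The reflection of a collection of cones in the origin. -/
def negFan {V : Type*} [AddCommGroup V] (F : Set (Set V)) : Set (Set V) :=
  (fun σ => -σ) '' F

/-- The support of a collection of cones. -/
def support {V : Type*} (F : Set (Set V)) : Set V :=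
  ⋃₀ F

/-! ### The lower and the upper bound on the initial ideal -/

/-- The projection `ρ_Δ` from `ℂ[x_e]_{e ∈ E}` to its subring `ℂ[Δ]` of polynomials in the `x_e`,
`e ∈ Δ`: it fixes `x_e` for `e ∈ Δ` and takes the other variables to zero. -/
def rho {E : Type*} (Δ : Set E) : MvPolynomial E ℂ →ₐ[ℂ] MvPolynomial E ℂ :=
  open Classical in
  MvPolynomial.aeval fun e => if e ∈ Δ then MvPolynomial.X e else 0

/-- The image `I_Δ` of `I` under `ρ_Δ`. -/
def projIdeal {E : Type*} (I : Ideal (MvPolynomial E ℂ)) (Δ : Set E) : Set (MvPolynomial E ℂ) :=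
  rho Δ '' (I : Set (MvPolynomial E ℂ))

/-- The ideal `I_w`: the sum of the ideals generated by the `I_Δ` over all cells `Δ` of the
subdivision of `A(I)` induced by `w`. -/
def lowerIdeal {E : Type*} (I : Ideal (MvPolynomial E ℂ)) (w : E → ℝ) :
    Ideal (MvPolynomial E ℂ) :=
  ⨆ Δ ∈ regularSubdivision (configOfIdeal I) w, Ideal.span (projIdeal I Δ)

/-- The intersection `I ∩ ℂ[Δ]`. -/
def interIdeal {E : Type*} (I : Ideal (MvPolynomial E ℂ)) (Δ : Set E) : Set (MvPolynomial E ℂ) :=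
  (I : Set (MvPolynomial E ℂ)) ∩ (MvPolynomial.supported ℂ Δ : Set (MvPolynomial E ℂ))

/-- The ideal `I^w`: the intersection, over all cells `Δ` of the subdivision of `A(I)` induced by
`-w`, of the ideals generated by `I ∩ ℂ[Δ]` and all `x_e` with `e ∉ Δ`. -/
def upperIdeal {E : Type*} (I : Ideal (MvPolynomial E ℂ)) (w : E → ℝ) :
    Ideal (MvPolynomial E ℂ) :=
  ⨅ Δ ∈ regularSubdivision (configOfIdeal I) (-w),
    Ideal.span (interIdeal I Δ ∪ MvPolynomial.X '' Δᶜ)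

/-- The set `Ω(I)` of weights at which the lower bound is exact. -/
def lowerExact {E : Type*} (I : Ideal (MvPolynomial E ℂ)) : Set (E → ℝ) :=
  {w | lowerIdeal I w = initialIdeal w I}

/-- The set `Ω*(I)` of weights at which the upper bound is exact. -/
def upperExact {E : Type*} (I : Ideal (MvPolynomial E ℂ)) : Set (E → ℝ) :=
  {w | upperIdeal I w = initialIdeal w I}

end

end InitialDegeneration

/-! Put `L = linealitySpace I`; homogeneity of `I` gives `1 ∈ L`. A functional on the dual of `L` is
evaluation at some `u ∈ L`, and constants can be subtracted, so the cells of `w` are the nonempty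
zero sets of the nonnegative vectors in `w + L` (`mem_regularSubdivision_iff`). Say that `w` refines
`v` if every cell of `w` lies in a cell of `v`. The proof has two independent halves.

Convex geometry: the secondary cone of `w` is the set of all `v` refined by `w`
(`closure_zeroSets_eq`), and these cones form a fan. Hence every set of weights that is closed under
passing to coarser subdivisions is the support of a subfan (`exists_isSubfan_secondaryFan`). The
crux is `Refines.add_refines`: if `w` refines `v` and `v'`, then `v + v'` refines both. It rests on
linear programming duality (`exists_slack`).

Algebra: exactness passes to coarser subdivisions. Always `I_v ⊆ in_v I`, and if `w` refines `v`,
then `I_w ⊆ in_w (I_v)`. Taking initial ideals preserves Hilbert functions, so if `I_w = in_w I`,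
then `h(I) = h(I_w) ≤ h(in_w I_v) = h(I_v) ≤ h(in_v I) = h(I)`, whence `I_v = in_v I`. For the upper
bound the inclusions are reversed, `in_w (I^v) ⊆ I^w` and `in_v I ⊆ I^v`, and the subdivisions are
those of `-w` and `-v`; this accounts for the reflected fan. -/

namespace InitialDegeneration

open Filter Topology

/-! ### Finite intersections of half-spaces -/

/-- A set that is cut out by finitely many homogeneous linear inequalities. -/
def CutOutByFinite {V : Type*} [AddCommGroup V] [Module ℝ V] (S : Set V) : Prop :=
  ∃ F : Finset (Module.Dual ℝ V), ∀ x, x ∈ S ↔ ∀ f ∈ F, 0 ≤ f x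

namespace CutOutByFinite

variable {V : Type*} [AddCommGroup V] [Module ℝ V] {S : Set V}

/-- One step of Fourier-Motzkin elimination. -/
theorem add_ray (hS : CutOutByFinite S) (v : V) :
    CutOutByFinite {x | ∃ t : ℝ, 0 ≤ t ∧ x - t • v ∈ S} := by
  classical
  obtain ⟨F, hF⟩ := hS
  -- The conditions on `t` are `t * f v ≤ f x`: an upper bound if `f v > 0`, a lower bound if `f v <
  -- 0`. Eliminating `t` compares each upper bound with `0` and with each lower bound.
  refine ⟨F.filter (fun f => 0 ≤ f v) ∪ ((F.filter fun f => 0 < f v) ×ˢ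
    (F.filter fun f => f v < 0)).image (fun q => q.1 v • q.2 - q.2 v • q.1), fun x => ?_⟩
  simp only [Set.mem_ofPred_eq, hF, map_sub, map_smul, smul_eq_mul, sub_nonneg]
  constructor
  · rintro ⟨t, ht, h⟩ f hf
    simp only [Finset.mem_union, Finset.mem_filter, Finset.mem_image, Finset.mem_product,
      Prod.exists] at hf
    rcases hf with ⟨hf, hv⟩ | ⟨f₁, f₂, ⟨⟨h₁, hp⟩, h₂, hn⟩, rfl⟩
    · exact (mul_nonneg ht hv).trans (h f hf)
    · simp only [LinearMap.sub_apply, LinearMap.smul_apply, smul_eq_mul, sub_nonneg]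
      nlinarith [h f₁ h₁, h f₂ h₂]
  · intro h
    have hpos : ∀ f ∈ F, 0 ≤ f v → 0 ≤ f x := fun f hf hv =>
      h f (Finset.mem_union_left _ (Finset.mem_filter.2 ⟨hf, hv⟩))
    have hpair : ∀ f₁ ∈ F, ∀ f₂ ∈ F, 0 < f₁ v → f₂ v < 0 → 0 ≤ f₁ v * f₂ x - f₂ v * f₁ x := by
      intro f₁ h₁ f₂ h₂ hp hn
      have := h (f₁ v • f₂ - f₂ v • f₁) (Finset.mem_union_right _ (Finset.mem_image.2
        ⟨(f₁, f₂), by simp [h₁, h₂, hp, hn], rfl⟩))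
      simpa using this
    by_cases hall : ∀ f ∈ F, 0 ≤ f x
    · exact ⟨0, le_rfl, by simpa using hall⟩
    push Not at hall
    obtain ⟨g, hg, hgx⟩ := hall
    have hgv : g v < 0 := by
      by_contra hc
      exact absurd (hpos g hg (not_lt.1 hc)) (not_le.2 hgx)
    -- If `t = 0` fails, the greatest of the lower bounds is a valid `t`.
    obtain ⟨j, hj, hmax⟩ := (F.filter fun f => f v < 0).exists_max_image (fun f => f x / f v)
      ⟨g, by simp [hg, hgv]⟩
    simp only [Finset.mem_filter] at hj hmax
    have ht : 0 < j x / j v := (div_pos_of_neg_of_neg hgx hgv).trans_le (hmax g ⟨hg, hgv⟩)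
    have hjx : j x / j v * j v = j x := div_mul_cancel₀ _ hj.2.ne
    refine ⟨j x / j v, ht.le, fun f hf => ?_⟩
    set t := j x / j v
    rcases lt_trichotomy (f v) 0 with hv | hv | hv
    · have := hmax f ⟨hf, hv⟩
      rwa [div_le_iff_of_neg hv] at this
    · simpa [hv] using hpos f hf hv.ge
    · have := hpair f hf j hj.1 hv hj.2
      rw [← hjx] at this
      by_contra hc
      nlinarith [mul_pos_of_neg_of_neg hj.2 (sub_neg.2 (not_le.1 hc))]

theorem biInter {ι : Type*} {s : Set ι} (hs : s.Finite) {S : ι → Set V}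
    (h : ∀ i ∈ s, CutOutByFinite (S i)) : CutOutByFinite (⋂ i ∈ s, S i) := by
  classical
  choose! F hF using h
  refine ⟨hs.toFinset.biUnion F, fun x => ?_⟩
  simp only [Set.mem_iInter, Finset.mem_biUnion, Set.Finite.mem_toFinset, forall_exists_index,
    and_imp]
  exact ⟨fun h f i hi hf => (hF i hi x).1 (h i hi) f hf,
    fun h i hi => (hF i hi x).2 fun f hf => h f i hi hf⟩

theorem of_submodule [FiniteDimensional ℝ V] (L : Submodule ℝ V) :
    CutOutByFinite (L : Set V) := by
  classical
  obtain ⟨s, hs⟩ := (IsNoetherian.noetherian L.dualAnnihilator : L.dualAnnihilator.FG)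
  refine ⟨s ∪ s.image (fun f => -f), fun x => ⟨fun hx f hf => ?_, fun h => ?_⟩⟩
  · have key : ∀ f ∈ s, f x = 0 := fun f hf =>
      (Submodule.mem_dualAnnihilator f).1 (hs ▸ Submodule.subset_span hf) x hx
    rcases Finset.mem_union.1 hf with hf | hf
    · exact (key f hf).ge
    · obtain ⟨g, hg, rfl⟩ := Finset.mem_image.1 hf
      simp [key g hg]
  · have key : ∀ f ∈ s, f x = 0 := fun f hf => le_antisymm
      (by simpa using h (-f) (Finset.mem_union_right _ (Finset.mem_image_of_mem _ hf)))
      (h f (Finset.mem_union_left _ hf))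
    have hx : x ∈ L.dualAnnihilator.dualCoannihilator := by
      rw [Submodule.mem_dualCoannihilator]
      intro φ hφ
      rw [← hs] at hφ
      induction hφ using Submodule.span_induction with
      | mem f hf => exact key f hf
      | zero => rfl
      | add f g _ _ hf hg => simp [hf, hg]
      | smul c f _ hf => simp [hf]
    rwa [Subspace.dualAnnihilator_dualCoannihilator_eq] at hx

theorem isClosed [TopologicalSpace V] [IsTopologicalAddGroup V] [ContinuousSMul ℝ V] [T2Space V]
    [FiniteDimensional ℝ V] (hS : CutOutByFinite S) : IsClosed S := by
  obtain ⟨F, hF⟩ := hS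
  have : S = ⋂ f ∈ F, {x | 0 ≤ f x} := by
    ext x
    simp [hF]
  rw [this]
  exact isClosed_biInter fun f _ =>
    isClosed_le continuous_const (LinearMap.continuous_of_finiteDimensional f)

theorem isPolyhedralCone (hS : CutOutByFinite S) : IsPolyhedralCone S := by
  obtain ⟨F, hF⟩ := hS
  refine ⟨PointedCone.dual LinearMap.id (F : Set (Module.Dual ℝ V)), ⟨F, rfl⟩, ?_⟩
  ext x
  simp [hF]

end CutOutByFinite

/-! ### Nonnegative vectors modulo a subspace -/

section

variable {E : Type*} [Fintype E] (L : Submodule ℝ (E → ℝ))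

theorem eventually_pos_add_mul {x : E → ℝ} (y : E → ℝ) :
    ∀ᶠ ε in 𝓝[>] (0 : ℝ), ∀ e, 0 < x e → 0 < x e + ε * y e := by
  refine eventually_all.2 fun e => ?_
  by_cases hx : 0 < x e
  · have hc : Tendsto (fun ε : ℝ => x e + ε * y e) (𝓝[>] 0) (𝓝 (x e)) := by
      have : Continuous fun ε : ℝ => x e + ε * y e := by fun_prop
      simpa using (this.tendsto 0).mono_left nhdsWithin_le_nhds
    filter_upwards [hc.eventually (lt_mem_nhds hx)] with ε h _ using h
  · exact Eventually.of_forall fun ε h => absurd h hx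

theorem exists_pos_add_mul {x : E → ℝ} (y : E → ℝ) :
    ∃ ε : ℝ, 0 < ε ∧ ∀ e, 0 < x e → 0 < x e + ε * y e :=
  ((eventually_pos_add_mul y).and self_mem_nhdsWithin).exists.imp fun _ h => ⟨h.2, h.1⟩

/-- The weights that are, modulo `L`, nonnegative and zero on `Δ`. -/
def liftCone (Δ : Set E) : Set (E → ℝ) :=
  {v | ∃ u ∈ L, (∀ e, 0 ≤ u e + v e) ∧ ∀ e ∈ Δ, u e + v e = 0}

/-- The cone is `L` plus the rays spanned by the unit vectors outside `Δ`. For `Δ = E` it is `L`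
itself, and each label removed from `Δ` adds one ray, which is one elimination step. -/
theorem cutOutByFinite_liftCone (Δ : Set E) : CutOutByFinite (liftCone L Δ) := by
  classical
  suffices H : ∀ s : Finset E, CutOutByFinite (liftCone L (s : Set E)ᶜ) by
    simpa using H (Δᶜ).toFinset
  intro s
  induction s using Finset.induction_on with
  | empty =>
    convert CutOutByFinite.of_submodule L using 1
    ext v
    constructor
    · rintro ⟨u, hu, -, h⟩
      have : v = -u := by
        ext e
        have := h e (by simp)
        simp only [Pi.neg_apply]
        linarith
      rw [this]
      exact L.neg_mem hu
    · intro hv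
      exact ⟨-v, L.neg_mem hv, by simp, by simp⟩
  | insert a s ha ih =>
    convert ih.add_ray (Pi.single a 1) using 1
    ext v
    constructor
    · rintro ⟨u, hu, h0, h⟩
      refine ⟨u a + v a, h0 a, u, hu, fun e => ?_, fun e he => ?_⟩
      · rcases eq_or_ne e a with rfl | hne
        · simp
        · simpa [hne] using h0 e
      · rcases eq_or_ne e a with rfl | hne
        · simp
        · simpa [hne] using h e (by simpa [hne] using he)
    · rintro ⟨t, ht, u, hu, h0, h⟩
      refine ⟨u, hu, fun e => ?_, fun e he => ?_⟩
      · rcases eq_or_ne e a with rfl | hne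
        · have := h0 e
          simp at this
          linarith
        · simpa [hne] using h0 e
      · simp only [Finset.coe_insert, Set.mem_compl_iff, Set.mem_insert_iff, not_or] at he
        simpa [he.1] using h e he.2

/-- Complementary slackness: a nonnegative functional on `L` is represented by nonnegative
coefficients that are supported in a cell of `w`. -/
theorem exists_slack (h1 : (1 : E → ℝ) ∈ L) (w l : E → ℝ) (hl : ∀ e, 0 ≤ l e) :
    ∃ m : E → ℝ, (∀ e, 0 ≤ m e) ∧ (∀ u ∈ L, ∑ e, m e * u e = ∑ e, l e * u e) ∧
      ∃ u ∈ L, (∀ e, 0 ≤ u e + w e) ∧ ∀ e, m e * (u e + w e) = 0 := by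
  classical
  -- The dual linear program: minimize `∑ e, m e * w e` over all nonnegative representatives `m` of
  -- the functional that `l` defines on `L`.
  let K : Set (E → ℝ) := {m | (∀ e, 0 ≤ m e) ∧ ∀ u ∈ L, ∑ e, m e * u e = ∑ e, l e * u e}
  have hKclosed : IsClosed K := by
    have : K = (⋂ e, {m : E → ℝ | 0 ≤ m e}) ∩
        ⋂ u ∈ L, {m : E → ℝ | ∑ e, m e * u e = ∑ e, l e * u e} := by
      ext m
      simp [K]
    rw [this]
    refine (isClosed_iInter fun e => isClosed_le continuous_const (continuous_apply e)).inter
      (isClosed_biInter fun u _ => isClosed_eq ?_ continuous_const)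
    fun_prop
  -- Evaluating the functional at `1 ∈ L` fixes the sum of the entries of `m`; so `K` is bounded and
  -- a minimum is attained.
  have hKsub : K ⊆ Set.Icc 0 (fun _ => ∑ e, l e) := by
    rintro m ⟨hm, hmL⟩
    refine ⟨hm, fun e => ?_⟩
    have := hmL 1 h1
    simp only [Pi.one_apply, mul_one] at this
    rw [← this]
    exact Finset.single_le_sum (fun i _ => hm i) (Finset.mem_univ e)
  have hKcomp : IsCompact K := isCompact_Icc.of_isClosed_subset hKclosed hKsub
  have hcont : Continuous fun m : E → ℝ => ∑ e, m e * w e := by fun_prop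
  obtain ⟨m, hmK, hmin⟩ := hKcomp.exists_isMinOn ⟨l, hl, fun _ _ => rfl⟩ hcont.continuousOn
  refine ⟨m, hmK.1, hmK.2, ?_⟩
  by_cases hw : w ∈ liftCone L {e | m e ≠ 0}
  · obtain ⟨u, hu, h0, h⟩ := hw
    refine ⟨u, hu, h0, fun e => ?_⟩
    by_cases he : m e = 0
    · simp [he]
    · simp [h e he]
  exfalso
  -- Otherwise some inequality `f ≥ 0` valid on the cone fails at `w`. This `f` vanishes on `L` and
  -- is nonnegative on the unit vectors where `m` vanishes, so moving `m` slightly along its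
  -- coefficients stays in `K` and decreases the objective.
  obtain ⟨F, hF⟩ := cutOutByFinite_liftCone L {e | m e ≠ 0}
  have hw' := hw
  rw [hF] at hw'
  push Not at hw'
  obtain ⟨f, hf, hfw⟩ := hw'
  have hfC : ∀ x ∈ liftCone L {e | m e ≠ 0}, 0 ≤ f x := fun x hx => (hF x).1 hx f hf
  have hsum : ∀ x : E → ℝ, f x = ∑ e, f (Pi.single e 1) * x e := fun x => by
    rw [LinearMap.pi_apply_eq_sum_univ f x]
    refine Finset.sum_congr rfl fun e _ => ?_
    rw [smul_eq_mul, mul_comm]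
    congr 2
    ext i
    simp [Pi.single_apply, eq_comm]
  have hLmem : ∀ u ∈ L, u ∈ liftCone L {e | m e ≠ 0} := fun u hu =>
    ⟨-u, L.neg_mem hu, by simp, by simp⟩
  have hfL : ∀ u ∈ L, f u = 0 := fun u hu => by
    have h₁ := hfC u (hLmem u hu)
    have h₂ := hfC (-u) (hLmem _ (L.neg_mem hu))
    rw [map_neg] at h₂
    linarith
  have hfpos : ∀ e, m e = 0 → 0 ≤ f (Pi.single e 1) := fun e he => by
    refine hfC _ ⟨0, L.zero_mem, fun i => ?_, fun i hi => ?_⟩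
    · rcases eq_or_ne i e with rfl | h <;> simp [*]
    · have : i ≠ e := by
        rintro rfl
        exact hi he
      simp [this]
  obtain ⟨ε, hε, hpos⟩ := exists_pos_add_mul (x := m) (fun e => f (Pi.single e 1))
  have hmem : (fun e => m e + ε * f (Pi.single e 1)) ∈ K := by
    refine ⟨fun e => ?_, fun u hu => ?_⟩
    · change 0 ≤ m e + _
      rcases (hmK.1 e).eq_or_lt with he | he
      · rw [← he, zero_add]
        exact mul_nonneg hε.le (hfpos e he.symm)
      · exact (hpos e he).le
    · rw [← hmK.2 u hu]
      simp only [add_mul, mul_assoc, Finset.sum_add_distrib, ← Finset.mul_sum]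
      rw [← hsum, hfL u hu, mul_zero, add_zero]
  have := hmin hmem
  simp only [Set.mem_ofPred_eq, add_mul, mul_assoc, Finset.sum_add_distrib,
    ← Finset.mul_sum] at this
  rw [← hsum] at this
  nlinarith

end

end InitialDegeneration

/-! ### Refinement of subdivisions and the cones of the secondary fan -/

namespace InitialDegeneration

open Filter Topology

/-! ### The secondary fan -/

section

variable {E : Type*} (L : Submodule ℝ (E → ℝ))

/-- The zero sets of the nonnegative vectors in `w + L`. These are the cells of `w`, and the empty
set. -/
def zeroSets (w : E → ℝ) : Set (Set E) :=
  {Δ | ∃ u ∈ L, (∀ e, 0 ≤ u e + w e) ∧ Δ = {e | u e + w e = 0}}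

/-- Every cell of `w` is contained in a cell of `v`. -/
def Refines (w v : E → ℝ) : Prop :=
  ∀ Δ ∈ zeroSets L w, v ∈ liftCone L Δ

variable {L} {w v v' x : E → ℝ} {Δ Δ' : Set E}

theorem mem_liftCone_of_mem_zeroSets (h : Δ ∈ zeroSets L w) : w ∈ liftCone L Δ := by
  obtain ⟨u, hu, h0, rfl⟩ := h
  exact ⟨u, hu, h0, fun e he => he⟩

theorem exists_superset_of_mem_liftCone (h : v ∈ liftCone L Δ) :
    ∃ Δ' ∈ zeroSets L v, Δ ⊆ Δ' := by
  obtain ⟨u, hu, h0, h⟩ := h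
  exact ⟨_, ⟨u, hu, h0, rfl⟩, h⟩

theorem liftCone_anti (h : Δ ⊆ Δ') : liftCone L Δ' ⊆ liftCone L Δ := by
  rintro v ⟨u, hu, h0, h'⟩
  exact ⟨u, hu, h0, fun e he => h' e (h he)⟩

theorem Refines.refl (w : E → ℝ) : Refines L w w :=
  fun _ h => mem_liftCone_of_mem_zeroSets h

theorem Refines.exists_superset (h : Refines L w v) (hΔ : Δ ∈ zeroSets L w) :
    ∃ Δ' ∈ zeroSets L v, Δ ⊆ Δ' :=
  exists_superset_of_mem_liftCone (h Δ hΔ)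

theorem Refines.trans (h : Refines L w v) (h' : Refines L v x) : Refines L w x := by
  intro Δ hΔ
  obtain ⟨Δ', hΔ', hsub⟩ := h.exists_superset hΔ
  exact liftCone_anti hsub (h' Δ' hΔ')

theorem zero_mem_liftCone (Δ : Set E) : (0 : E → ℝ) ∈ liftCone L Δ :=
  ⟨0, L.zero_mem, by simp, by simp⟩

theorem add_mem_liftCone (h : v ∈ liftCone L Δ) (h' : v' ∈ liftCone L Δ) :
    v + v' ∈ liftCone L Δ := by
  obtain ⟨u, hu, h0, h⟩ := h
  obtain ⟨u', hu', h0', h'⟩ := h'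
  refine ⟨u + u', L.add_mem hu hu', fun e => ?_, fun e he => ?_⟩
  · have := h0 e
    have := h0' e
    simp only [Pi.add_apply]
    linarith
  · have := h e he
    have := h' e he
    simp only [Pi.add_apply]
    linarith

theorem smul_mem_liftCone {c : ℝ} (hc : 0 ≤ c) (h : v ∈ liftCone L Δ) :
    c • v ∈ liftCone L Δ := by
  obtain ⟨u, hu, h0, h⟩ := h
  refine ⟨c • u, L.smul_mem c hu, fun e => ?_, fun e he => ?_⟩
  · simpa [mul_add] using mul_nonneg hc (h0 e)
  · simp [← mul_add, h e he]

variable (L) in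
/-- The cone of all weights that are refined by `w`. -/
def refinedCone (w : E → ℝ) : PointedCone ℝ (E → ℝ) where
  carrier := {v | Refines L w v}
  zero_mem' := fun _ _ => zero_mem_liftCone _
  add_mem' := fun h h' Δ hΔ => add_mem_liftCone (h Δ hΔ) (h' Δ hΔ)
  smul_mem' := fun c _ h Δ hΔ => smul_mem_liftCone c.2 (h Δ hΔ)

theorem mem_refinedCone : v ∈ refinedCone L w ↔ Refines L w v := Iff.rfl

theorem Refines.add (h : Refines L w v) (h' : Refines L w v') : Refines L w (v + v') :=
  (refinedCone L w).add_mem h h'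

theorem Refines.smul {c : ℝ} (hc : 0 ≤ c) (h : Refines L w v) : Refines L w (c • v) :=
  fun Δ hΔ => smul_mem_liftCone hc (h Δ hΔ)

theorem Refines.of_smul {c : ℝ} (hc : 0 < c) (h : Refines L w (c • v)) : Refines L w v := by
  have := h.smul (inv_nonneg.2 hc.le)
  rwa [inv_smul_smul₀ hc.ne'] at this

variable [Fintype E]

theorem cutOutByFinite_refinedCone (w : E → ℝ) :
    CutOutByFinite (refinedCone L w : Set (E → ℝ)) := by
  convert CutOutByFinite.biInter (Set.toFinite (zeroSets L w))
    (fun Δ _ => cutOutByFinite_liftCone L Δ) using 1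
  ext v
  simp [mem_refinedCone, Refines]

/-- The sum of two weights that are refined by a common weight refines both. -/
theorem Refines.add_refines (h1 : (1 : E → ℝ) ∈ L) (h : Refines L w v) (h' : Refines L w v') :
    Refines L (v + v') v := by
  classical
  rintro _ ⟨U, hU, hU0, rfl⟩
  -- Let `l` be the indicator of the given zero set of `v + v'`. It is traded for an `m` that agrees
  -- with it on `L` but is supported in a cell of `w`, where refinement gives information about `v`
  -- and `v'` separately.
  obtain ⟨m, hm, hmL, y, hy, hy0, hmy⟩ := exists_slack L h1 w
    (Set.indicator {e | U e + (v + v') e = 0} 1) (fun e => Set.indicator_nonneg (by simp) e)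
  set l : E → ℝ := Set.indicator {e | U e + (v + v') e = 0} 1 with hl
  have hl0 : ∀ e, 0 ≤ l e := fun e => Set.indicator_nonneg (by simp) e
  have hΔ : {e | y e + w e = 0} ∈ zeroSets L w := ⟨y, hy, hy0, rfl⟩
  obtain ⟨u, hu, hu0, huz⟩ := h _ hΔ
  obtain ⟨u', hu', hu'0, hu'z⟩ := h' _ hΔ
  have hmz : ∀ e, m e * (u e + v e + (u' e + v' e)) = 0 := fun e => by
    rcases mul_eq_zero.1 (hmy e) with he | he
    · simp [he]
    · simp [huz e he, hu'z e he]
  have hlz : ∀ e, l e * (U e + (v e + v' e)) = 0 := fun e => by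
    by_cases he : U e + (v + v') e = 0
    · simp only [Pi.add_apply] at he
      simp [he]
    · have : l e = 0 := Set.indicator_of_notMem (s := {e | U e + (v + v') e = 0}) he 1
      simp [this]
  have e1 := hmL _ (L.add_mem hu hu')
  have e2 := hmL U hU
  have s1 : ∑ e, m e * (u e + v e + (u' e + v' e)) = 0 := Finset.sum_eq_zero fun e _ => hmz e
  have s2 : ∑ e, l e * (U e + (v e + v' e)) = 0 := Finset.sum_eq_zero fun e _ => hlz e
  have s3 : 0 ≤ ∑ e, m e * (U e + (v e + v' e)) :=
    Finset.sum_nonneg fun e _ => mul_nonneg (hm e) (hU0 e)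
  have nn : ∀ e, 0 ≤ l e * (u e + v e + (u' e + v' e)) := fun e =>
    mul_nonneg (hl0 e) (add_nonneg (hu0 e) (hu'0 e))
  -- Since `l` kills `U + v + v'` and `m` kills `u + v + u' + v'`, the sum equals the value of `l`,
  -- hence of `m`, at `u + u' - U`, which is `-∑ e, m e * (U e + (v e + v' e)) ≤ 0`.
  have s4 : ∑ e, l e * (u e + v e + (u' e + v' e)) = 0 := by
    refine le_antisymm ?_ (Finset.sum_nonneg fun e _ => nn e)
    simp only [Pi.add_apply, mul_add, Finset.sum_add_distrib] at *
    linarith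
  refine ⟨u, hu, hu0, fun e he => ?_⟩
  have hle : l e = 1 := Set.indicator_of_mem he 1
  have := (Finset.sum_eq_zero_iff_of_nonneg fun e _ => nn e).1 s4 e (Finset.mem_univ e)
  rw [hle, one_mul] at this
  have := hu0 e
  have := hu'0 e
  linarith

/-- Mutual refinement literally matches only the maximal cells; a smaller zero set of `w` is
recovered inside a larger one of `v` by a small perturbation. -/
theorem Refines.zeroSets_subset (h : Refines L w v) (h' : Refines L v w) :
    zeroSets L w ⊆ zeroSets L v := by
  rintro _ ⟨u, hu, hu0, rfl⟩
  obtain ⟨U, hU, hU0, hUz⟩ := h _ ⟨u, hu, hu0, rfl⟩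
  obtain ⟨y, hy, hy0, hyz⟩ := h' _ ⟨U, hU, hU0, rfl⟩
  obtain ⟨ε, hε, hpos⟩ := exists_pos_add_mul (x := fun e => U e + v e) (fun e => u e - y e)
  have key : ∀ e, U e + v e = 0 → u e - y e = u e + w e := fun e he => by
    have := hyz e he
    linarith
  have hne : ∀ e, U e + v e ≠ 0 → 0 < U e + v e + ε * (u e - y e) := fun e he =>
    hpos e ((hU0 e).lt_of_ne' he)
  -- On the zero set of `U + v` the correction `u - y` equals `u + w`, because `y + w` vanishes
  -- there; it cuts out the original zero set. Elsewhere `U + v` is positive and dominates for small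
  -- `ε`.
  refine ⟨U + ε • (u - y), L.add_mem hU (L.smul_mem _ (L.sub_mem hu hy)), fun e => ?_, ?_⟩
  · simp only [Pi.add_apply, Pi.smul_apply, Pi.sub_apply, smul_eq_mul, add_right_comm _ _ (v e)]
    by_cases he : U e + v e = 0
    · rw [he, key e he, zero_add]
      exact mul_nonneg hε.le (hu0 e)
    · exact (hne e he).le
  · ext e
    simp only [Set.mem_ofPred_eq, Pi.add_apply, Pi.smul_apply, Pi.sub_apply, smul_eq_mul,
      add_right_comm _ _ (v e)]
    by_cases he : U e + v e = 0
    · rw [he, key e he, zero_add]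
      simp [hε.ne']
    · exact iff_of_false (fun h => he (hUz e h)) (hne e he).ne'

theorem zeroSets_eq_iff : zeroSets L w = zeroSets L v ↔ Refines L w v ∧ Refines L v w := by
  constructor
  · intro h
    exact ⟨fun Δ hΔ => mem_liftCone_of_mem_zeroSets (h ▸ hΔ),
      fun Δ hΔ => mem_liftCone_of_mem_zeroSets (h ▸ hΔ)⟩
  · rintro ⟨h, h'⟩
    exact (h.zeroSets_subset h').antisymm (h'.zeroSets_subset h)

/-- Being refined by `w` is a closed condition. Conversely, if `w` refines `v`, then each `ε • w +
v` with `ε > 0` has the subdivision of `w`: it refines `w` by `Refines.add_refines`. Let `ε` tend to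
`0`. -/
theorem closure_zeroSets_eq (h1 : (1 : E → ℝ) ∈ L) (w : E → ℝ) :
    closure {v | zeroSets L v = zeroSets L w} = refinedCone L w := by
  apply Set.Subset.antisymm
  · refine closure_minimal (fun v hv => ?_) (cutOutByFinite_refinedCone w).isClosed
    exact (zeroSets_eq_iff.1 hv).2
  · intro v hv
    have hlim : Tendsto (fun ε : ℝ => ε • w + v) (𝓝[>] 0) (𝓝 v) := by
      have : Continuous fun ε : ℝ => ε • w + v := by fun_prop
      simpa using (this.tendsto 0).mono_left nhdsWithin_le_nhds
    refine mem_closure_of_tendsto hlim ?_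
    filter_upwards [self_mem_nhdsWithin] with ε hε
    have hw : Refines L w (ε • w) := (Refines.refl w).smul (le_of_lt hε)
    exact zeroSets_eq_iff.2 ⟨(hw.add_refines h1 hv).of_smul hε, hw.add hv⟩

/-- This says that `v` is a relative interior point of its own cone: one can move from `v` slightly
away from any `x` in the cone. -/
theorem Refines.exists_sub_smul (h : Refines L v x) : ∃ ε : ℝ, 0 < ε ∧ Refines L v (v - ε • x) := by
  have H : ∀ Δ ∈ zeroSets L v, ∀ᶠ ε in 𝓝[>] (0 : ℝ), v - ε • x ∈ liftCone L Δ := by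
    intro Δ hΔ
    obtain ⟨y, hy, hy0, hyz⟩ := h Δ hΔ
    obtain ⟨u, hu, hu0, rfl⟩ := hΔ
    filter_upwards [eventually_pos_add_mul (x := fun e => u e + v e) fun e => -(y e + x e)]
      with ε hε
    have hz : ∀ e, u e + v e = 0 → (u - ε • y) e + (v - ε • x) e = 0 := fun e he => by
      simp only [Pi.sub_apply, Pi.smul_apply, smul_eq_mul]
      linear_combination he - ε * hyz e he
    refine ⟨u - ε • y, L.sub_mem hu (L.smul_mem _ hy), fun e => ?_, hz⟩
    by_cases he : u e + v e = 0
    · exact (hz e he).ge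
    · have := hε e ((hu0 e).lt_of_ne' he)
      simp only [Pi.sub_apply, Pi.smul_apply, smul_eq_mul]
      linarith
  have := ((eventually_all_finite (Set.toFinite (zeroSets L v))).2 H).and self_mem_nhdsWithin
  exact this.exists.imp fun ε h => ⟨h.2, h.1⟩

/-- If `v` refines a sum `a • x + y` of members of the cone of `w`, it also refines `x`, since the
sum refines its summands. -/
theorem refinedCone_inf_isFaceOf (h1 : (1 : E → ℝ) ∈ L) (w v : E → ℝ) :
    (refinedCone L w ⊓ refinedCone L v).IsFaceOf (refinedCone L w) where
  le := inf_le_left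
  mem_of_smul_add_mem := by
    intro x y a hx hy ha h
    refine ⟨hx, ?_⟩
    have hax : Refines L w (a • x) := Refines.smul ha.le hx
    exact Refines.trans (Submodule.mem_inf.1 h).2 ((hax.add_refines h1 hy).of_smul ha)

/-- Every face of the cone of weights that are refined by `w` is again such a cone. -/
theorem exists_eq_refinedCone_of_isFaceOf (h1 : (1 : E → ℝ) ∈ L) {T : PointedCone ℝ (E → ℝ)}
    (hT : T.IsFaceOf (refinedCone L w)) : ∃ v ∈ T, T = refinedCone L v := by
  -- Write `v` as `ε • x + (v - ε • x)` with both summands in the cone of `w`; the face property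
  -- puts `x` into `T`.
  have hsub : ∀ v ∈ T, refinedCone L v ≤ T := by
    intro v hv x hx
    obtain ⟨ε, hε, h⟩ := Refines.exists_sub_smul hx
    have hwv : Refines L w v := hT.le hv
    refine hT.mem_of_smul_add_mem (hwv.trans hx) (hwv.trans h) hε ?_
    simpa using hv
  -- A `v ∈ T` with finest subdivision. Without one, adding elements of `T` would give an endless
  -- chain of proper refinements, while there are only finitely many families of subsets of `E`.
  obtain ⟨v, hv, hmax⟩ : ∃ v ∈ T, ∀ v' ∈ T, zeroSets L v = zeroSets L (v + v') := by
    by_contra! hcon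
    choose! f hfT hf using hcon
    let g : ℕ → E → ℝ := fun n => (fun x => x + f x)^[n] 0
    have hg : ∀ n, g (n + 1) = g n + f (g n) := fun n => by
      simp only [g, Function.iterate_succ_apply']
    have hgT : ∀ n, g n ∈ T := by
      intro n
      induction n with
      | zero => exact T.zero_mem
      | succ n ih => exact hg n ▸ T.add_mem ih (hfT _ ih)
    have hstep : ∀ n, Refines L (g (n + 1)) (g n) := fun n =>
      hg n ▸ Refines.add_refines h1 (hT.le (hgT n)) (hT.le (hfT _ (hgT n)))
    have hanti : ∀ m n, m ≤ n → Refines L (g n) (g m) := by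
      intro m n hmn
      induction n, hmn using Nat.le_induction with
      | base => exact Refines.refl _
      | succ n _ ih => exact (hstep n).trans ih
    obtain ⟨m, n, hne, heq⟩ := Finite.exists_ne_map_eq_of_infinite fun n => zeroSets L (g n)
    wlog hmn : m < n generalizing m n
    · exact this n m hne.symm heq.symm (lt_of_le_of_ne (not_lt.1 hmn) hne.symm)
    refine hf _ (hgT m) ?_
    rw [← hg, zeroSets_eq_iff]
    exact ⟨(zeroSets_eq_iff.1 heq).1.trans (hanti _ _ hmn), hstep m⟩
  refine ⟨v, hv, le_antisymm (fun x hx => ?_) (hsub v hv)⟩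
  have : Refines L (v + x) x := by
    rw [add_comm]
    exact Refines.add_refines h1 (hT.le hx) (hT.le hv)
  exact (zeroSets_eq_iff.1 (hmax x hx)).1.trans this

/-- The cones over a class of weights that is closed under coarsening form a fan. -/
theorem isPolyhedralFan_refinedCone (h1 : (1 : E → ℝ) ∈ L) {Ω : Set (E → ℝ)}
    (hΩ : ∀ w ∈ Ω, ∀ v, Refines L w v → v ∈ Ω) :
    IsPolyhedralFan ((fun w => (refinedCone L w : Set (E → ℝ))) '' Ω) where
  finite := by
    have : ((fun w => (refinedCone L w : Set (E → ℝ))) '' Ω) ⊆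
        Set.range fun T : Set (Set E) => {v | ∀ Δ ∈ T, v ∈ liftCone L Δ} := by
      rintro _ ⟨w, -, rfl⟩
      exact ⟨zeroSets L w, rfl⟩
    exact (Set.finite_range _).subset this
  polyhedral := by
    rintro _ ⟨w, -, rfl⟩
    exact (cutOutByFinite_refinedCone w).isPolyhedralCone
  face_mem := by
    rintro _ ⟨w, hw, rfl⟩ _ ⟨T, C, hTC, rfl, hC⟩
    obtain rfl : C = refinedCone L w := SetLike.coe_injective hC
    obtain ⟨v, hv, rfl⟩ := exists_eq_refinedCone_of_isFaceOf h1 hTC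
    exact ⟨v, hΩ w hw v (hTC.le hv), rfl⟩
  inter_face := by
    rintro _ ⟨w, hw, rfl⟩ _ ⟨v, hv, rfl⟩
    refine ⟨⟨_, _, refinedCone_inf_isFaceOf h1 w v, rfl, rfl⟩,
      ⟨_, _, refinedCone_inf_isFaceOf h1 v w, ?_, rfl⟩⟩
    rw [Submodule.coe_inf, Set.inter_comm]

/-! ### Comparison with regular subdivisions -/

theorem mem_regularSubdivision_iff (h1 : (1 : E → ℝ) ∈ L) (w : E → ℝ) (Δ : Set E) :
    Δ ∈ regularSubdivision (configOfSubspace L) w ↔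
      Δ ∈ zeroSets L w ∧ (Δ.Nonempty ∨ IsEmpty E) := by
  have hface : ∀ u : L, face (lift (configOfSubspace L) w)
      ((Module.evalEquiv ℝ L u).coprod (LinearMap.id : ℝ →ₗ[ℝ] ℝ)) =
        {e' | ∀ e, (u : E → ℝ) e' + w e' ≤ (u : E → ℝ) e + w e} := fun u => rfl
  constructor
  · rintro ⟨f, rfl⟩
    obtain ⟨u, rfl⟩ := (Module.evalEquiv ℝ L).surjective f
    rw [hface]
    rcases isEmpty_or_nonempty E with hE | hE
    · exact ⟨⟨0, L.zero_mem, fun e => isEmptyElim e, Set.ext fun e => isEmptyElim e⟩, Or.inr hE⟩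
    · obtain ⟨e₀, he₀⟩ := Finite.exists_min fun e => (u : E → ℝ) e + w e
      refine ⟨⟨u - ((u : E → ℝ) e₀ + w e₀) • (1 : E → ℝ), L.sub_mem u.2 (L.smul_mem _ h1),
        fun e => ?_, ?_⟩, Or.inl ⟨e₀, he₀⟩⟩
      · have := he₀ e
        simp only [Pi.sub_apply, Pi.smul_apply, Pi.one_apply, smul_eq_mul]
        linarith
      · ext e
        simp only [Set.mem_ofPred_eq, Pi.sub_apply, Pi.smul_apply, Pi.one_apply, smul_eq_mul]
        constructor
        · intro h
          have := h e₀
          have := he₀ e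
          linarith
        · intro h e'
          have := he₀ e'
          linarith
  · rintro ⟨⟨u, hu, hu0, rfl⟩, hne⟩
    refine ⟨Module.evalEquiv ℝ L ⟨u, hu⟩, ?_⟩
    rw [hface]
    ext e
    simp only [Set.mem_ofPred_eq]
    constructor
    · intro h e'
      rw [h]
      exact hu0 e'
    · intro h
      rcases hne with ⟨e', he'⟩ | hE
      · exact le_antisymm ((h e').trans he'.le) (hu0 e)
      · exact isEmptyElim e

/-- The empty set is not a cell if `E` is nonempty, but it is a zero set for every weight, so
admitting it does not affect comparisons between weights. -/
theorem empty_mem_zeroSets (h1 : (1 : E → ℝ) ∈ L) (w : E → ℝ) : (∅ : Set E) ∈ zeroSets L w := by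
  have hpos : ∀ e, 0 < (∑ i, |w i|) + 1 + w e := fun e => by
    have := Finset.single_le_sum (fun i _ => abs_nonneg (w i)) (Finset.mem_univ e)
    have := neg_abs_le (w e)
    linarith
  refine ⟨((∑ i, |w i|) + 1) • (1 : E → ℝ), L.smul_mem _ h1, fun e => ?_, ?_⟩
  · simpa using (hpos e).le
  · ext e
    simpa using (hpos e).ne'

theorem regularSubdivision_eq_iff (h1 : (1 : E → ℝ) ∈ L) (v w : E → ℝ) :
    regularSubdivision (configOfSubspace L) v = regularSubdivision (configOfSubspace L) w ↔
      zeroSets L v = zeroSets L w := by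
  constructor
  · intro h
    ext Δ
    rcases Δ.eq_empty_or_nonempty with rfl | hΔ
    · simp [empty_mem_zeroSets h1]
    · have := Set.ext_iff.1 h Δ
      simpa [mem_regularSubdivision_iff h1, hΔ] using this
  · intro h
    ext Δ
    rw [mem_regularSubdivision_iff h1, mem_regularSubdivision_iff h1, h]

theorem secondaryCone_eq (h1 : (1 : E → ℝ) ∈ L) (w : E → ℝ) :
    secondaryCone (configOfSubspace L) (regularSubdivision (configOfSubspace L) w) =
      refinedCone L w := by
  rw [secondaryCone, ← closure_zeroSets_eq h1]
  simp only [regularSubdivision_eq_iff h1]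

theorem secondaryFan_eq (h1 : (1 : E → ℝ) ∈ L) :
    secondaryFan (configOfSubspace L) =
      (fun w => (refinedCone L w : Set (E → ℝ))) '' Set.univ := by
  ext σ
  simp only [secondaryFan, Set.mem_ofPred_eq, secondaryCone_eq h1, Set.image_univ, Set.mem_range,
    eq_comm]

theorem Refines.exists_cell_superset (h1 : (1 : E → ℝ) ∈ L) (h : Refines L w v)
    (hΔ : Δ ∈ regularSubdivision (configOfSubspace L) w) :
    ∃ Δ' ∈ regularSubdivision (configOfSubspace L) v, Δ ⊆ Δ' := by
  rw [mem_regularSubdivision_iff h1] at hΔ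
  obtain ⟨Δ', hΔ', hsub⟩ := h.exists_superset hΔ.1
  exact ⟨Δ', (mem_regularSubdivision_iff h1 _ _).2 ⟨hΔ', hΔ.2.imp_left (·.mono hsub)⟩, hsub⟩

/-- A class of weights that is closed under coarsening is the support of a subfan of the secondary
fan. -/
theorem exists_isSubfan_secondaryFan (h1 : (1 : E → ℝ) ∈ L) {Ω : Set (E → ℝ)}
    (hΩ : ∀ w ∈ Ω, ∀ v, Refines L w v → v ∈ Ω) :
    ∃ G, IsSubfan G (secondaryFan (configOfSubspace L)) ∧ support G = Ω := by
  refine ⟨_, ⟨?_, isPolyhedralFan_refinedCone h1 hΩ, ?_⟩, ?_⟩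
  · rw [secondaryFan_eq h1]
    exact isPolyhedralFan_refinedCone h1 fun _ _ _ _ => trivial
  · rw [secondaryFan_eq h1]
    exact Set.image_mono (Set.subset_univ _)
  · apply Set.Subset.antisymm
    · rintro v ⟨_, ⟨w, hw, rfl⟩, hv⟩
      exact hΩ w hw v hv
    · exact fun w hw => ⟨_, ⟨w, hw, rfl⟩, Refines.refl w⟩

end

/-! ### Reflection in the origin -/

section

variable {V : Type*} [AddCommGroup V] [Module ℝ V]

theorem neg_coe_eq_comap (C : PointedCone ℝ V) :
    -(C : Set V) = (C.comap (-LinearMap.id : V →ₗ[ℝ] V) : Set V) := by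
  ext x
  simp

theorem IsPolyhedralCone.neg {σ : Set V} (h : IsPolyhedralCone σ) : IsPolyhedralCone (-σ) := by
  obtain ⟨C, ⟨F, hF⟩, rfl⟩ := h
  refine CutOutByFinite.isPolyhedralCone ⟨F.map ⟨fun f => -f, neg_injective⟩, fun x => ?_⟩
  rw [Set.mem_neg, SetLike.mem_coe, ← hF]
  simp

theorem IsFaceOfCone.neg {τ σ : Set V} (h : IsFaceOfCone τ σ) : IsFaceOfCone (-τ) (-σ) := by
  obtain ⟨T, C, hTC, rfl, rfl⟩ := h
  refine ⟨_, _, ⟨?_, ?_⟩, (neg_coe_eq_comap T).symm, (neg_coe_eq_comap C).symm⟩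
  · exact fun x hx => hTC.le hx
  · intro x y a hx hy ha h
    refine hTC.mem_of_smul_add_mem hx hy ha ?_
    simp only [PointedCone.mem_comap] at h
    simpa [add_comm] using h

theorem IsPolyhedralFan.neg {F : Set (Set V)} (h : IsPolyhedralFan F) :
    IsPolyhedralFan (negFan F) where
  finite := h.finite.image _
  polyhedral := by
    rintro _ ⟨σ, hσ, rfl⟩
    exact (h.polyhedral σ hσ).neg
  face_mem := by
    rintro _ ⟨σ, hσ, rfl⟩ τ hτ
    refine ⟨-τ, h.face_mem σ hσ _ ?_, neg_neg τ⟩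
    simpa using hτ.neg
  inter_face := by
    rintro _ ⟨σ, hσ, rfl⟩ _ ⟨τ, hτ, rfl⟩
    simp only [← Set.inter_neg]
    exact ⟨(h.inter_face σ hσ τ hτ).1.neg, (h.inter_face σ hσ τ hτ).2.neg⟩

theorem IsSubfan.neg {G F : Set (Set V)} (h : IsSubfan G F) : IsSubfan (negFan G) (negFan F) :=
  ⟨h.fan.neg, h.subfan.neg, Set.image_mono h.subset⟩

theorem support_negFan {V : Type*} [AddCommGroup V] (F : Set (Set V)) :
    support (negFan F) = -support F := by
  ext x
  simp [support, negFan]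

end

end InitialDegeneration

/-! ### Initial ideals and their Hilbert functions -/

namespace InitialDegeneration

open MvPolynomial Module

/-! ### Initial forms and lower bounds on the weight -/

section

variable {E : Type*} {u w : E → ℝ} {p : MvPolynomial E ℂ} {J K : Ideal (MvPolynomial E ℂ)}

theorem weight_add (u w : E → ℝ) (d : E →₀ ℕ) :
    Finsupp.weight (u + w) d = Finsupp.weight u d + Finsupp.weight w d := by
  simp [Finsupp.weight_apply, Finsupp.sum, Finset.sum_add_distrib]

theorem weight_neg (w : E → ℝ) (d : E →₀ ℕ) :
    Finsupp.weight (-w) d = -Finsupp.weight w d := by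
  simp [Finsupp.weight_apply, Finsupp.sum]

theorem weight_nonneg (hw : ∀ e, 0 ≤ w e) (d : E →₀ ℕ) : 0 ≤ Finsupp.weight w d := by
  rw [Finsupp.weight_apply]
  exact Finset.sum_nonneg fun e _ => nsmul_nonneg (hw e) _

theorem weight_eq_zero_iff (hw : ∀ e, 0 ≤ w e) (d : E →₀ ℕ) :
    Finsupp.weight w d = 0 ↔ ∀ e ∈ d.support, w e = 0 := by
  rw [Finsupp.weight_apply, Finsupp.sum,
    Finset.sum_eq_zero_iff_of_nonneg fun e _ => nsmul_nonneg (hw e) _]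
  refine forall₂_congr fun e he => ?_
  simp [Finsupp.mem_support_iff.1 he]

theorem weightedHomogeneousComponent_comm (u w : E → ℝ) (b c : ℝ) (p : MvPolynomial E ℂ) :
    weightedHomogeneousComponent u b (weightedHomogeneousComponent w c p) =
      weightedHomogeneousComponent w c (weightedHomogeneousComponent u b p) := by
  classical
  ext d
  simp only [coeff_weightedHomogeneousComponent]
  split_ifs <;> rfl

theorem weightedHomogeneousComponent_monomial_mul (w : E → ℝ) (c : ℝ) (d : E →₀ ℕ) (r : ℂ)
    (p : MvPolynomial E ℂ) : weightedHomogeneousComponent w c (monomial d r * p) =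
      monomial d r * weightedHomogeneousComponent w (c - Finsupp.weight w d) p := by
  classical
  ext a
  simp only [coeff_weightedHomogeneousComponent, coeff_monomial_mul']
  by_cases hd : d ≤ a
  · have ha : Finsupp.weight w a = Finsupp.weight w (a - d) + Finsupp.weight w d := by
      rw [← map_add, tsub_add_cancel_of_le hd]
    simp [hd, ha, eq_sub_iff_add_eq]
  · simp [hd]

theorem mem_of_forall_weightedHomogeneousComponent_mem (w : E → ℝ)
    (h : ∀ c, weightedHomogeneousComponent w c p ∈ J) : p ∈ J := by
  rw [← sum_weightedHomogeneousComponent w p,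
    finsum_eq_sum _ (weightedHomogeneousComponent_finsupp p)]
  exact Ideal.sum_mem _ fun c _ => h c

/-- The initial form is the component at a lower bound for the weights. -/
theorem exists_initialForm_eq (w : E → ℝ) (p : MvPolynomial E ℂ) :
    ∃ m, (∀ d ∈ p.support, m ≤ Finsupp.weight w d) ∧
      initialForm w p = weightedHomogeneousComponent w m p :=
  ⟨_, fun d hd => csInf_le ((Finset.finite_toSet _).image _).bddBelow ⟨d, hd, rfl⟩, rfl⟩

/-- The component at a lower bound for the weights is the initial form, unless it vanishes. -/
theorem eq_zero_or_eq_initialForm {m : ℝ} (hm : ∀ d ∈ p.support, m ≤ Finsupp.weight w d) :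
    weightedHomogeneousComponent w m p = 0 ∨
      weightedHomogeneousComponent w m p = initialForm w p := by
  classical
  refine or_iff_not_imp_left.2 fun h0 => ?_
  obtain ⟨d, hd⟩ := support_nonempty.2 h0
  rw [support_weightedHomogeneousComponent, Finset.mem_filter] at hd
  rw [initialForm]
  suffices H : m = sInf (Finsupp.weight w '' (p.support : Set (E →₀ ℕ))) by rw [← H]
  refine le_antisymm (le_csInf ⟨_, d, hd.1, rfl⟩ ?_) ?_
  · rintro _ ⟨d, hd, rfl⟩
    exact hm d hd
  · rw [← hd.2]
    exact csInf_le ((Finset.finite_toSet _).image _).bddBelow (Set.mem_image_of_mem _ hd.1)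

theorem component_mem_initialIdeal (hp : p ∈ J) {m : ℝ}
    (hm : ∀ d ∈ p.support, m ≤ Finsupp.weight w d) :
    weightedHomogeneousComponent w m p ∈ initialIdeal w J := by
  rcases eq_zero_or_eq_initialForm hm with h | h
  · rw [h]
    exact Ideal.zero_mem _
  · rw [h]
    exact Ideal.subset_span ⟨p, hp, rfl⟩

theorem initialIdeal_le (h : ∀ p ∈ J, ∀ m, (∀ d ∈ p.support, m ≤ Finsupp.weight w d) →
    weightedHomogeneousComponent w m p ∈ K) : initialIdeal w J ≤ K := by
  rw [initialIdeal, Ideal.span_le]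
  rintro _ ⟨p, hp, rfl⟩
  obtain ⟨m, hm, he⟩ := exists_initialForm_eq w p
  rw [he]
  exact h p hp m hm

theorem mem_linealitySpace_iff : u ∈ linealitySpace J ↔
    ∀ p ∈ J, ∀ c, weightedHomogeneousComponent u c p ∈ J :=
  initialIdeal_eq_self_iff u J

theorem support_component_subset (w : E → ℝ) (c : ℝ) (p : MvPolynomial E ℂ) :
    (weightedHomogeneousComponent w c p).support ⊆ p.support := by
  classical
  rw [support_weightedHomogeneousComponent]
  exact Finset.filter_subset _ _

/-- The `u`-components of `p ∈ J` lie in `J`, and on each of them the weights `u + w` and `w` differ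
by a constant. -/
theorem initialIdeal_add_le (hu : u ∈ linealitySpace J) (w : E → ℝ) :
    initialIdeal (u + w) J ≤ initialIdeal w J := by
  classical
  refine initialIdeal_le fun p hp m hm => ?_
  have hsum : weightedHomogeneousComponent (u + w) m p
      = ∑ b ∈ p.support.image (Finsupp.weight u),
        weightedHomogeneousComponent w (m - b) (weightedHomogeneousComponent u b p) := by
    ext a
    simp only [coeff_sum, coeff_weightedHomogeneousComponent, weight_add]
    by_cases ha : a ∈ p.support
    · rw [Finset.sum_eq_single (Finsupp.weight u a)]
      · simp [eq_sub_iff_add_eq, add_comm]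
      · intro b _ hb
        simp [Ne.symm hb]
      · intro hcon
        exact absurd (Finset.mem_image_of_mem _ ha) hcon
    · simp [notMem_support_iff.mp ha]
  rw [hsum]
  refine Ideal.sum_mem _ fun b _ =>
    component_mem_initialIdeal (mem_linealitySpace_iff.1 hu p hp b) fun d hd => ?_
  rw [support_weightedHomogeneousComponent, Finset.mem_filter] at hd
  have := hm d hd.1
  rw [weight_add, hd.2] at this
  linarith

theorem initialIdeal_add (hu : u ∈ linealitySpace J) (w : E → ℝ) :
    initialIdeal (u + w) J = initialIdeal w J := by
  refine le_antisymm (initialIdeal_add_le hu w) ?_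
  simpa using initialIdeal_add_le ((linealitySpace J).neg_mem hu) (u + w)

/-! ### Homogeneity of spans, sums and intersections -/

theorem mem_linealitySpace_span {S : Set (MvPolynomial E ℂ)}
    (hS : ∀ s ∈ S, ∀ c, weightedHomogeneousComponent u c s ∈ Ideal.span S) :
    u ∈ linealitySpace (Ideal.span S) := by
  classical
  rw [mem_linealitySpace_iff]
  intro p hp
  induction hp using Submodule.span_induction with
  | mem s hs => exact hS s hs
  | zero => simp
  | add x y _ _ hx hy =>
    intro c
    rw [map_add]
    exact Ideal.add_mem _ (hx c) (hy c)
  | smul a x _ hx =>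
    intro c
    rw [smul_eq_mul]
    induction a using MvPolynomial.induction_on' with
    | monomial d r =>
      rw [weightedHomogeneousComponent_monomial_mul]
      exact Ideal.mul_mem_left _ _ (hx _)
    | add a b ha hb =>
      rw [add_mul, map_add]
      exact Ideal.add_mem _ ha hb

theorem mem_linealitySpace_initialIdeal (hu : u ∈ linealitySpace J) (w : E → ℝ) :
    u ∈ linealitySpace (initialIdeal w J) := by
  refine mem_linealitySpace_span ?_
  rintro _ ⟨p, hp, rfl⟩ c
  obtain ⟨m, hm, he⟩ := exists_initialForm_eq w p
  rw [he, weightedHomogeneousComponent_comm]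
  exact component_mem_initialIdeal (mem_linealitySpace_iff.1 hu p hp c)
    fun d hd => hm d (support_component_subset _ _ _ hd)

theorem mem_linealitySpace_iSup {ι : Sort*} {J : ι → Ideal (MvPolynomial E ℂ)}
    (h : ∀ i, u ∈ linealitySpace (J i)) : u ∈ linealitySpace (⨆ i, J i) := by
  have hspan : ⨆ i, J i = Ideal.span (⋃ i, (J i : Set (MvPolynomial E ℂ))) := by
    rw [Ideal.span_iUnion]
    simp only [Ideal.span_eq]
  rw [hspan]
  refine mem_linealitySpace_span fun s hs c => ?_
  obtain ⟨i, hi⟩ := Set.mem_iUnion.1 hs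
  exact Ideal.subset_span (Set.mem_iUnion.2 ⟨i, mem_linealitySpace_iff.1 (h i) s hi c⟩)

theorem mem_linealitySpace_iInf {ι : Sort*} {J : ι → Ideal (MvPolynomial E ℂ)}
    (h : ∀ i, u ∈ linealitySpace (J i)) : u ∈ linealitySpace (⨅ i, J i) := by
  rw [mem_linealitySpace_iff]
  intro p hp c
  rw [Ideal.mem_iInf] at *
  exact fun i => mem_linealitySpace_iff.1 (h i) p (hp i) c

/-! ### The Hilbert function of the initial ideal -/

/-- The span of the initial forms of the elements of a space of polynomials. -/
noncomputable def initialSpace (w : E → ℝ) (V : Submodule ℂ (MvPolynomial E ℂ)) :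
    Submodule ℂ (MvPolynomial E ℂ) :=
  Submodule.span ℂ (initialForm w '' (V : Set (MvPolynomial E ℂ)))

theorem initialSpace_le_restrictSupport {M : Set (E →₀ ℕ)} {V : Submodule ℂ (MvPolynomial E ℂ)}
    (hV : V ≤ restrictSupport ℂ M) (w : E → ℝ) : initialSpace w V ≤ restrictSupport ℂ M := by
  rw [initialSpace, Submodule.span_le]
  rintro _ ⟨p, hp, rfl⟩
  have hs : (p.support : Set (E →₀ ℕ)) ⊆ M := hV hp
  exact subset_trans (Finset.coe_subset.2 (support_component_subset _ _ _)) hs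

theorem finiteDimensional_restrictSupport {M : Set (E →₀ ℕ)} (hM : M.Finite) :
    FiniteDimensional ℂ (restrictSupport ℂ M) := by
  have := hM.to_subtype
  exact Module.Finite.of_basis (basisRestrictSupport ℂ M)

/-- Let `π` take the component of the least weight occurring in `M`. The initial forms of `V` span
the direct sum of `π V` and the initial space of `V ∩ ker π`, which involves fewer weights.
Rank-nullity and induction on the number of weights conclude. -/
theorem finrank_initialSpace (w : E → ℝ) {M : Set (E →₀ ℕ)} (hM : M.Finite)
    {V : Submodule ℂ (MvPolynomial E ℂ)} (hV : V ≤ restrictSupport ℂ M) :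
    finrank ℂ (initialSpace w V) = finrank ℂ V := by
  classical
  obtain ⟨n, hn⟩ : ∃ n, (Finsupp.weight w '' M).ncard = n := ⟨_, rfl⟩
  induction n using Nat.strong_induction_on generalizing M V with
  | _ n ih =>
    have hfin := hM.image (Finsupp.weight w)
    rcases M.eq_empty_or_nonempty with rfl | hne
    · have hbot : restrictSupport ℂ (∅ : Set (E →₀ ℕ)) = ⊥ := by
        rw [eq_bot_iff]
        intro p hp
        have : (p.support : Set (E →₀ ℕ)) ⊆ ∅ := hp
        simpa using this
      rw [hbot, le_bot_iff] at hV
      have : initialSpace w V = ⊥ := by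
        subst hV
        simp [initialSpace, initialForm]
      rw [this, hV]
    obtain ⟨c, ⟨d₀, hd₀, hd₀c⟩, hmin⟩ := Set.exists_min_image _ id hfin (hne.image _)
    have hmin' : ∀ d ∈ M, c ≤ Finsupp.weight w d := fun d hd => hmin _ ⟨d, hd, rfl⟩
    let π := weightedHomogeneousComponent (R := ℂ) w c
    let M' : Set (E →₀ ℕ) := {d ∈ M | Finsupp.weight w d ≠ c}
    let V' : Submodule ℂ (MvPolynomial E ℂ) := V ⊓ LinearMap.ker π
    have hsupp : ∀ p ∈ V, ∀ d ∈ p.support, d ∈ M := fun p hp d hd => hV hp hd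
    have hV' : V' ≤ restrictSupport ℂ M' := by
      rintro p ⟨hp, hker⟩ d hd
      refine ⟨hsupp p hp d hd, fun hc => MvPolynomial.mem_support_iff.1 hd ?_⟩
      have := congrArg (coeff d) (LinearMap.mem_ker.1 hker)
      simpa [π, coeff_weightedHomogeneousComponent, hc] using this
    have hM' : M'.Finite := hM.subset fun d hd => hd.1
    have hlt : (Finsupp.weight w '' M').ncard < n := by
      rw [← hn]
      refine Set.ncard_lt_ncard ⟨Set.image_mono fun d hd => hd.1, fun hcon => ?_⟩ hfin
      obtain ⟨d, hd, hdc⟩ := hcon ⟨d₀, hd₀, hd₀c⟩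
      exact hd.2 hdc
    have hsplit : initialSpace w V = V.map π ⊔ initialSpace w V' := by
      apply le_antisymm
      · rw [initialSpace, Submodule.span_le]
        rintro _ ⟨p, hp, rfl⟩
        rcases eq_zero_or_eq_initialForm (w := w) (p := p) (m := c)
          (fun d hd => hmin' d (hsupp p hp d hd)) with h | h
        · exact Submodule.mem_sup_right (Submodule.subset_span ⟨p, ⟨hp, h⟩, rfl⟩)
        · rw [← h]
          exact Submodule.mem_sup_left ⟨p, hp, rfl⟩
      · refine sup_le ?_ (Submodule.span_mono (Set.image_mono inf_le_left))
        rintro _ ⟨p, hp, rfl⟩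
        rcases eq_zero_or_eq_initialForm (w := w) (p := p) (m := c)
          (fun d hd => hmin' d (hsupp p hp d hd)) with h | h
        · exact h ▸ Submodule.zero_mem _
        · exact h ▸ Submodule.subset_span ⟨p, hp, rfl⟩
    have hdisj : V.map π ⊓ initialSpace w V' = ⊥ := by
      rw [eq_bot_iff]
      rintro q ⟨⟨p, hp, rfl⟩, hq⟩
      have hq' := initialSpace_le_restrictSupport hV' w hq
      rw [Submodule.mem_bot]
      by_contra h0
      obtain ⟨d, hd⟩ := support_nonempty.2 h0
      have h₁ : d ∈ M' := hq' hd
      rw [support_weightedHomogeneousComponent, Finset.mem_filter] at hd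
      exact h₁.2 hd.2
    have := finiteDimensional_restrictSupport hM
    have := finiteDimensional_restrictSupport hM'
    have : FiniteDimensional ℂ V := Submodule.finiteDimensional_of_le hV
    have : FiniteDimensional ℂ (initialSpace w V') :=
      Submodule.finiteDimensional_of_le (initialSpace_le_restrictSupport hV' w)
    have e1 := Submodule.finrank_sup_add_finrank_inf_eq (V.map π) (initialSpace w V')
    rw [hdisj, finrank_bot, add_zero, ← hsplit, ih _ hlt hM' hV' rfl] at e1
    have e2 := LinearMap.finrank_range_add_finrank_ker (π.domRestrict V)
    have e3 : LinearMap.range (π.domRestrict V) = V.map π := by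
      rw [LinearMap.domRestrict, LinearMap.range_comp, Submodule.range_subtype]
    have e4 : finrank ℂ (LinearMap.ker (π.domRestrict V)) = finrank ℂ V' := by
      rw [LinearMap.ker_domRestrict, ← Submodule.finrank_map_subtype_eq, Submodule.map_comap_subtype]
    rw [e3, e4] at e2
    omega

/-- The part of an ideal in a given degree. -/
noncomputable def gradedPiece (J : Ideal (MvPolynomial E ℂ)) (c : ℝ) :
    Submodule ℂ (MvPolynomial E ℂ) :=
  J.restrictScalars ℂ ⊓ restrictSupport ℂ {d | Finsupp.weight (1 : E → ℝ) d = c}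

theorem component_mem_gradedPiece (hJ : (1 : E → ℝ) ∈ linealitySpace J) (hp : p ∈ J) (c : ℝ) :
    weightedHomogeneousComponent 1 c p ∈ gradedPiece J c := by
  classical
  refine ⟨mem_linealitySpace_iff.1 hJ p hp c, fun d hd => ?_⟩
  have hd' : d ∈ (weightedHomogeneousComponent (1 : E → ℝ) c p).support := hd
  rw [support_weightedHomogeneousComponent, Finset.mem_filter] at hd'
  exact hd'.2

theorem gradedPiece_mono (h : J ≤ K) (c : ℝ) : gradedPiece J c ≤ gradedPiece K c :=
  inf_le_inf_right _ h

/-- A monomial times an initial form is again an initial form, and taking the degree `c` part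
commutes with taking `w`-components. So linear spans of initial forms suffice in each degree. -/
theorem gradedPiece_initialIdeal (hJ : (1 : E → ℝ) ∈ linealitySpace J) (w : E → ℝ) (c : ℝ) :
    gradedPiece (initialIdeal w J) c = initialSpace w (gradedPiece J c) := by
  classical
  apply le_antisymm
  · have key : ∀ q ∈ initialIdeal w J, ∀ a : MvPolynomial E ℂ,
        weightedHomogeneousComponent 1 c (a * q) ∈ initialSpace w (gradedPiece J c) := by
      intro q hq
      induction hq using Submodule.span_induction with
      | mem s hs =>
        obtain ⟨p, hp, rfl⟩ := hs
        obtain ⟨m, hm, he⟩ := exists_initialForm_eq w p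
        intro a
        induction a using MvPolynomial.induction_on' with
        | monomial d r =>
          have hmul : monomial d r * initialForm w p =
              weightedHomogeneousComponent w (m + Finsupp.weight w d) (monomial d r * p) := by
            rw [weightedHomogeneousComponent_monomial_mul, add_sub_cancel_right, he]
          rw [hmul, weightedHomogeneousComponent_comm]
          have hlow : ∀ b ∈ (weightedHomogeneousComponent (1 : E → ℝ) c
              (monomial d r * p)).support, m + Finsupp.weight w d ≤ Finsupp.weight w b := by
            intro b hb
            have hb' := support_component_subset _ _ _ hb
            rw [MvPolynomial.mem_support_iff, coeff_monomial_mul'] at hb'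
            have hdb : d ≤ b := by
              by_contra hcon
              exact hb' (if_neg hcon)
            rw [if_pos hdb] at hb'
            have := hm (b - d) (MvPolynomial.mem_support_iff.2 (right_ne_zero_of_mul hb'))
            rw [← tsub_add_cancel_of_le hdb, map_add]
            linarith
          rcases eq_zero_or_eq_initialForm hlow with h | h
          · exact h ▸ Submodule.zero_mem _
          · exact h ▸ Submodule.subset_span
              ⟨_, component_mem_gradedPiece hJ (J.mul_mem_left _ hp) c, rfl⟩
        | add a b ha hb =>
          rw [add_mul, map_add]
          exact Submodule.add_mem _ ha hb
      | zero => simp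
      | add x y _ _ hx hy =>
        intro a
        rw [mul_add, map_add]
        exact Submodule.add_mem _ (hx a) (hy a)
      | smul b x _ hx =>
        intro a
        rw [smul_eq_mul, ← mul_assoc]
        exact hx _
    rintro q ⟨hq, hqs⟩
    have hhom : IsWeightedHomogeneous (1 : E → ℝ) q c := fun d hd =>
      hqs (MvPolynomial.mem_support_iff.2 hd)
    have := key q hq 1
    rwa [one_mul, weightedHomogeneousComponent_eq_self hhom] at this
  · rw [initialSpace, Submodule.span_le]
    rintro _ ⟨p, ⟨hp, hps⟩, rfl⟩
    have hps' : (p.support : Set (E →₀ ℕ)) ⊆ {d | Finsupp.weight (1 : E → ℝ) d = c} := hps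
    exact ⟨Ideal.subset_span ⟨p, hp, rfl⟩,
      subset_trans (Finset.coe_subset.2 (support_component_subset _ _ _)) hps'⟩

variable [Finite E]

theorem finite_setOf_weight_one_eq (c : ℝ) :
    {d : E →₀ ℕ | Finsupp.weight (1 : E → ℝ) d = c}.Finite := by
  classical
  refine (Set.finite_Icc 0 (Finsupp.equivFunOnFinite.symm fun _ => ⌊c⌋₊)).subset
    fun d hd => ⟨zero_le, fun e => ?_⟩
  change d e ≤ ⌊c⌋₊
  refine Nat.le_floor ?_
  rw [← (hd : Finsupp.weight (1 : E → ℝ) d = c)]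
  by_cases he : e ∈ d.support
  · rw [Finsupp.weight_apply, Finsupp.sum]
    have := Finset.single_le_sum (f := fun e => d e • (1 : E → ℝ) e)
      (fun i _ => nsmul_nonneg zero_le_one _) he
    simpa using this
  · rw [Finsupp.notMem_support_iff.1 he]
    simpa using weight_nonneg (w := (1 : E → ℝ)) (fun _ => zero_le_one) d

instance finiteDimensional_gradedPiece (J : Ideal (MvPolynomial E ℂ)) (c : ℝ) :
    FiniteDimensional ℂ (gradedPiece J c) :=
  have := finiteDimensional_restrictSupport (finite_setOf_weight_one_eq (E := E) c)
  Submodule.finiteDimensional_of_le inf_le_right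

/-- An ideal and its initial ideal have the same Hilbert function. -/
theorem finrank_gradedPiece_initialIdeal (hJ : (1 : E → ℝ) ∈ linealitySpace J) (w : E → ℝ)
    (c : ℝ) : finrank ℂ (gradedPiece (initialIdeal w J) c) = finrank ℂ (gradedPiece J c) := by
  rw [gradedPiece_initialIdeal hJ]
  exact finrank_initialSpace w (finite_setOf_weight_one_eq c) inf_le_right

theorem eq_of_le_of_finrank_gradedPiece_le (hK : (1 : E → ℝ) ∈ linealitySpace K) (h : J ≤ K)
    (hr : ∀ c, finrank ℂ (gradedPiece K c) ≤ finrank ℂ (gradedPiece J c)) : J = K := by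
  refine le_antisymm h fun p hp => mem_of_forall_weightedHomogeneousComponent_mem 1 fun c => ?_
  have := component_mem_gradedPiece hK hp c
  rw [← Submodule.eq_of_le_of_finrank_le (gradedPiece_mono h c) (hr c)] at this
  exact this.1

end

end InitialDegeneration

/-! ### The two bounds and their behaviour under coarsening -/

namespace InitialDegeneration

open MvPolynomial Module

section

variable {E : Type*} {u v w x : E → ℝ} {p : MvPolynomial E ℂ} {I J K : Ideal (MvPolynomial E ℂ)}
  {Δ Δ' : Set E}

/-! ### The projections to coordinate subrings -/

open Classical in
theorem coeff_rho (Δ : Set E) (p : MvPolynomial E ℂ) (d : E →₀ ℕ) :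
    coeff d (rho Δ p) = if (d.support : Set E) ⊆ Δ then coeff d p else 0 := by
  induction p using MvPolynomial.induction_on' with
  | monomial a r =>
    have hrho : rho Δ (monomial a r) = if (a.support : Set E) ⊆ Δ then monomial a r else 0 := by
      rw [rho, aeval_monomial]
      split_ifs with h
      · rw [monomial_eq, algebraMap_eq]
        congr 1
        refine Finsupp.prod_congr fun e he => ?_
        rw [if_pos (h he)]
      · obtain ⟨e, he, heΔ⟩ := Set.not_subset.1 h
        rw [Finsupp.prod, Finset.prod_eq_zero he, mul_zero]
        rw [if_neg heΔ, zero_pow (Finsupp.mem_support_iff.1 he)]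
    rw [hrho]
    by_cases had : a = d
    · subst had
      split_ifs <;> simp
    · split_ifs <;> simp [coeff_monomial, had]
  | add p q hp hq =>
    rw [map_add, coeff_add, hp, hq, coeff_add]
    split_ifs <;> simp

theorem mem_supported_iff_support : p ∈ supported ℂ Δ ↔
    ∀ d ∈ p.support, (d.support : Set E) ⊆ Δ := by
  rw [mem_supported]
  constructor
  · intro h d hd e he
    exact h ((mem_vars_iff_mem_support e).2 ⟨d, hd, he⟩)
  · intro h e he
    obtain ⟨d, hd, hed⟩ := (mem_vars_iff_mem_support e).1 he
    exact h d hd hed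

theorem rho_eq_self (h : p ∈ supported ℂ Δ) : rho Δ p = p := by
  classical
  ext d
  rw [coeff_rho]
  split_ifs with hd
  · rfl
  · by_contra hc
    exact hd (mem_supported_iff_support.1 h d (MvPolynomial.mem_support_iff.2 (Ne.symm hc)))

theorem rho_rho (h : Δ ⊆ Δ') (p : MvPolynomial E ℂ) : rho Δ (rho Δ' p) = rho Δ p := by
  classical
  ext d
  simp only [coeff_rho]
  split_ifs with h₁ h₂ <;> first | rfl | exact absurd (h₁.trans h) h₂

theorem weightedHomogeneousComponent_rho (w : E → ℝ) (c : ℝ) (p : MvPolynomial E ℂ) :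
    weightedHomogeneousComponent w c (rho Δ p) = rho Δ (weightedHomogeneousComponent w c p) := by
  classical
  ext d
  simp only [coeff_rho, coeff_weightedHomogeneousComponent]
  split_ifs <;> rfl

theorem weight_eq_zero_iff_support_subset (hx : ∀ e, 0 ≤ x e) (d : E →₀ ℕ) :
    Finsupp.weight x d = 0 ↔ (d.support : Set E) ⊆ {e | x e = 0} :=
  weight_eq_zero_iff hx d

/-- For a nonnegative weight, the monomials of weight zero are those in the variables of weight
zero. This turns projections to cells into initial forms. -/
theorem weightedHomogeneousComponent_zero_eq_rho (hx : ∀ e, 0 ≤ x e) (p : MvPolynomial E ℂ) :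
    weightedHomogeneousComponent x 0 p = rho {e | x e = 0} p := by
  classical
  ext d
  simp only [coeff_rho, coeff_weightedHomogeneousComponent, weight_eq_zero_iff_support_subset hx]

/-! ### The lower bound -/

theorem mem_linealitySpace_lowerIdeal (hu : u ∈ linealitySpace I) (w : E → ℝ) :
    u ∈ linealitySpace (lowerIdeal I w) := by
  refine mem_linealitySpace_iSup fun Δ => mem_linealitySpace_iSup fun _ =>
    mem_linealitySpace_span ?_
  rintro _ ⟨p, hp, rfl⟩ c
  rw [weightedHomogeneousComponent_rho]
  exact Ideal.subset_span ⟨_, mem_linealitySpace_iff.1 hu p hp c, rfl⟩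

theorem rho_mem_initialIdeal (hu : u ∈ linealitySpace J) (h0 : ∀ e, 0 ≤ u e + w e) (hp : p ∈ J) :
    rho {e | u e + w e = 0} p ∈ initialIdeal w J := by
  rw [← initialIdeal_add hu w]
  have := weightedHomogeneousComponent_zero_eq_rho (x := u + w) h0 p
  simp only [Pi.add_apply] at this
  rw [← this]
  exact component_mem_initialIdeal hp fun d _ => weight_nonneg h0 d

/-- The ideal generated by `I ∩ ℂ[Δ]` and the variables outside of `Δ`. -/
noncomputable def cellIdeal (I : Ideal (MvPolynomial E ℂ)) (Δ : Set E) :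
    Ideal (MvPolynomial E ℂ) :=
  Ideal.span (interIdeal I Δ ∪ X '' Δᶜ)

theorem mem_cellIdeal_of_support (h : ∀ d ∈ p.support, ¬ (d.support : Set E) ⊆ Δ) :
    p ∈ cellIdeal I Δ := by
  refine Ideal.span_mono Set.subset_union_right (mem_ideal_span_X_image.2 fun d hd => ?_)
  obtain ⟨e, he, heΔ⟩ := Set.not_subset.1 (h d hd)
  exact ⟨e, heΔ, Finsupp.mem_support_iff.1 he⟩

/-- The projection `rho Δ` fixes `I ∩ ℂ[Δ]` and kills the variables outside `Δ`, so it maps the cell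
ideal into `I`. -/
theorem mem_of_mem_cellIdeal (hp : p ∈ cellIdeal I Δ) (hs : p ∈ supported ℂ Δ) : p ∈ I := by
  classical
  have hle : cellIdeal I Δ ≤ I.comap (rho Δ) := by
    refine Ideal.span_le.2 ?_
    rintro q (⟨hq, hqs⟩ | ⟨e, he, rfl⟩)
    · change rho Δ q ∈ I
      rwa [rho_eq_self hqs]
    · change rho Δ (X e) ∈ I
      rw [rho, aeval_X, if_neg he]
      exact I.zero_mem
  have : rho Δ p ∈ I := hle hp
  rwa [rho_eq_self hs] at this

theorem mem_linealitySpace_cellIdeal (hu : u ∈ linealitySpace I) (Δ : Set E) :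
    u ∈ linealitySpace (cellIdeal I Δ) := by
  classical
  refine mem_linealitySpace_span ?_
  rintro q (⟨hq, hqs⟩ | ⟨e, he, rfl⟩) c
  · refine Ideal.subset_span (Or.inl ⟨mem_linealitySpace_iff.1 hu q hq c, ?_⟩)
    exact mem_supported_iff_support.2 fun d hd =>
      mem_supported_iff_support.1 hqs d (support_component_subset _ _ _ hd)
  · have hX : IsWeightedHomogeneous u (X e : MvPolynomial E ℂ) (u e) :=
      isWeightedHomogeneous_X ℂ u e
    rw [weightedHomogeneousComponent_of_mem hX]
    split_ifs
    · exact Ideal.subset_span (Or.inr ⟨e, he, rfl⟩)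
    · exact Ideal.zero_mem _

theorem mem_linealitySpace_upperIdeal (hu : u ∈ linealitySpace I) (w : E → ℝ) :
    u ∈ linealitySpace (upperIdeal I w) :=
  mem_linealitySpace_iInf fun Δ => mem_linealitySpace_iInf fun _ =>
    mem_linealitySpace_cellIdeal hu Δ

/-- Replace `w` by `-u + w`, which is nonpositive and vanishes exactly on `Δ`. An initial form of
weight zero then comes from a `p` lying in `ℂ[Δ]`; one of nonzero weight has a variable outside `Δ`
in every monomial. Allowing `J` to differ from `I` covers both `J = I` and `J = upperIdeal I v`. -/
theorem initialIdeal_le_cellIdeal (hu : u ∈ linealitySpace J) (h0 : ∀ e, 0 ≤ u e + -w e)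
    (hJ : ∀ p ∈ J, p ∈ supported ℂ {e | u e + -w e = 0} → p ∈ I) :
    initialIdeal w J ≤ cellIdeal I {e | u e + -w e = 0} := by
  classical
  rw [← initialIdeal_add ((linealitySpace J).neg_mem hu) w]
  refine initialIdeal_le fun p hp m hm => ?_
  have hneg : ∀ d : E →₀ ℕ, Finsupp.weight (-u + w) d = -Finsupp.weight (u + -w) d := fun d => by
    rw [← weight_neg, neg_add, neg_neg]
  have hzero : ∀ d : E →₀ ℕ, Finsupp.weight (-u + w) d = 0 ↔
      (d.support : Set E) ⊆ {e | u e + -w e = 0} := fun d => by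
    rw [hneg, neg_eq_zero]
    exact weight_eq_zero_iff_support_subset (x := u + -w) h0 d
  have hnonpos : ∀ d : E →₀ ℕ, Finsupp.weight (-u + w) d ≤ 0 := fun d => by
    rw [hneg]
    exact neg_nonpos.2 (weight_nonneg (w := u + -w) h0 d)
  rcases eq_or_ne m 0 with rfl | hm0
  · have hs : p ∈ supported ℂ {e | u e + -w e = 0} := mem_supported_iff_support.2 fun d hd =>
      (hzero d).1 (le_antisymm (hnonpos d) (hm d hd))
    have hhom : IsWeightedHomogeneous (-u + w) p 0 := fun d hd =>
      (hzero d).2 (mem_supported_iff_support.1 hs d (MvPolynomial.mem_support_iff.2 hd))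
    rw [weightedHomogeneousComponent_eq_self hhom]
    exact Ideal.subset_span (Or.inl ⟨hJ p hp hs, hs⟩)
  · refine mem_cellIdeal_of_support fun d hd hsub => hm0 ?_
    rw [support_weightedHomogeneousComponent, Finset.mem_filter] at hd
    rw [← hd.2]
    exact (hzero d).2 hsub

variable [Fintype E] (h1 : (1 : E → ℝ) ∈ linealitySpace I)
include h1

theorem exists_of_mem_regularSubdivision (hΔ : Δ ∈ regularSubdivision (configOfIdeal I) w) :
    ∃ u ∈ linealitySpace I, (∀ e, 0 ≤ u e + w e) ∧ Δ = {e | u e + w e = 0} :=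
  ((mem_regularSubdivision_iff h1 w Δ).1 hΔ).1

theorem lowerIdeal_le_initialIdeal (w : E → ℝ) : lowerIdeal I w ≤ initialIdeal w I := by
  refine iSup₂_le fun Δ hΔ => Ideal.span_le.2 ?_
  obtain ⟨u, hu, h0, rfl⟩ := exists_of_mem_regularSubdivision h1 hΔ
  rintro _ ⟨p, hp, rfl⟩
  exact rho_mem_initialIdeal hu h0 hp

/-- For cells `Δ ⊆ Δ'` of `w` and `v`, `rho Δ p` is the projection of `rho Δ' p ∈ lowerIdeal I v`.
It is a component of lowest possible weight for `u + w`, and `u` preserves `lowerIdeal I v`. -/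
theorem lowerIdeal_le_initialIdeal_lowerIdeal (h : Refines (linealitySpace I) w v) :
    lowerIdeal I w ≤ initialIdeal w (lowerIdeal I v) := by
  refine iSup₂_le fun Δ hΔ => Ideal.span_le.2 ?_
  obtain ⟨Δ', hΔ', hsub⟩ := h.exists_cell_superset h1 hΔ
  obtain ⟨u, hu, h0, rfl⟩ := exists_of_mem_regularSubdivision h1 hΔ
  rintro _ ⟨p, hp, rfl⟩
  rw [← rho_rho hsub]
  refine rho_mem_initialIdeal (mem_linealitySpace_lowerIdeal hu v) h0 ?_
  exact Ideal.mem_iSup_of_mem Δ' (Ideal.mem_iSup_of_mem hΔ' (Ideal.subset_span ⟨p, hp, rfl⟩))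

theorem mem_lowerExact_of_refines (hw : w ∈ lowerExact I) (h : Refines (linealitySpace I) w v) :
    v ∈ lowerExact I := by
  refine eq_of_le_of_finrank_gradedPiece_le (mem_linealitySpace_initialIdeal h1 v)
    (lowerIdeal_le_initialIdeal h1 v) fun c => ?_
  rw [finrank_gradedPiece_initialIdeal h1, ← finrank_gradedPiece_initialIdeal h1 w,
    ← (hw : lowerIdeal I w = initialIdeal w I),
    ← finrank_gradedPiece_initialIdeal (mem_linealitySpace_lowerIdeal h1 v) w]
  exact Submodule.finrank_mono
    (gradedPiece_mono (lowerIdeal_le_initialIdeal_lowerIdeal h1 h) c)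

/-! ### The upper bound -/

theorem initialIdeal_le_upperIdeal (w : E → ℝ) : initialIdeal w I ≤ upperIdeal I w := by
  refine le_iInf₂ fun Δ hΔ => ?_
  obtain ⟨u, hu, h0, rfl⟩ := exists_of_mem_regularSubdivision h1 hΔ
  exact initialIdeal_le_cellIdeal hu h0 fun p hp _ => hp

/-- For cells `Δ ⊆ Δ'` of `-w` and `-v`, an element of `upperIdeal I v` in `ℂ[Δ]` lies in `ℂ[Δ']`
and in the cell ideal of `Δ'`, hence in `I`. -/
theorem initialIdeal_upperIdeal_le (h : Refines (linealitySpace I) (-w) (-v)) :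
    initialIdeal w (upperIdeal I v) ≤ upperIdeal I w := by
  refine le_iInf₂ fun Δ hΔ => ?_
  obtain ⟨Δ', hΔ', hsub⟩ := h.exists_cell_superset h1 hΔ
  obtain ⟨u, hu, h0, rfl⟩ := exists_of_mem_regularSubdivision h1 hΔ
  refine initialIdeal_le_cellIdeal (mem_linealitySpace_upperIdeal hu v) h0 fun p hp hs => ?_
  have hp' : p ∈ cellIdeal I Δ' := (Ideal.mem_iInf.1 ((Ideal.mem_iInf.1 hp) Δ')) hΔ'
  exact mem_of_mem_cellIdeal hp' (supported_mono hsub hs)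

theorem mem_upperExact_of_refines (hw : w ∈ upperExact I)
    (h : Refines (linealitySpace I) (-w) (-v)) : v ∈ upperExact I := by
  refine (eq_of_le_of_finrank_gradedPiece_le (mem_linealitySpace_upperIdeal h1 v)
    (initialIdeal_le_upperIdeal h1 v) fun c => ?_).symm
  rw [finrank_gradedPiece_initialIdeal h1, ← finrank_gradedPiece_initialIdeal h1 w,
    ← (hw : upperIdeal I w = initialIdeal w I),
    ← finrank_gradedPiece_initialIdeal (mem_linealitySpace_upperIdeal h1 v) w]
  exact Submodule.finrank_mono (gradedPiece_mono (initialIdeal_upperIdeal_le h1 h) c)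

end

theorem one_mem_linealitySpace {E : Type*} {I : Ideal (MvPolynomial E ℂ)}
    (hI : ∀ p ∈ I, ∀ n : ℕ, homogeneousComponent n p ∈ I) : (1 : E → ℝ) ∈ linealitySpace I := by
  classical
  rw [mem_linealitySpace_iff]
  intro p hp c
  have hdeg : ∀ d : E →₀ ℕ, Finsupp.weight (1 : E → ℝ) d = (d.degree : ℕ) := fun d => by
    simp [Finsupp.weight_apply, Finsupp.sum, Finsupp.degree_apply]
  -- Components are indexed by real numbers; those at a `c` that is not a natural number vanish.
  by_cases hc : ∃ n : ℕ, (n : ℝ) = c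
  · obtain ⟨n, rfl⟩ := hc
    convert hI p hp n using 1
    ext d
    rw [coeff_weightedHomogeneousComponent, coeff_homogeneousComponent, hdeg]
    simp
  · rw [weightedHomogeneousComponent_eq_zero']
    · exact I.zero_mem
    · exact fun d _ hd => hc ⟨_, (hdeg d).symm.trans hd⟩

end InitialDegeneration

theorem theoremC {E : Type*} [Finite E] (I : Ideal (MvPolynomial E ℂ))
    (hI : ∀ p ∈ I, ∀ n : ℕ, MvPolynomial.homogeneousComponent n p ∈ I) :
    (∃ G : Set (Set (E → ℝ)),
      InitialDegeneration.IsSubfan G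
        (InitialDegeneration.secondaryFan (InitialDegeneration.configOfIdeal I)) ∧
      InitialDegeneration.support G = InitialDegeneration.lowerExact I) ∧
    (∃ G : Set (Set (E → ℝ)),
      InitialDegeneration.IsSubfan G
        (InitialDegeneration.negFan
          (InitialDegeneration.secondaryFan (InitialDegeneration.configOfIdeal I))) ∧
      InitialDegeneration.support G = InitialDegeneration.upperExact I) := by
  cases nonempty_fintype E
  have h1 := InitialDegeneration.one_mem_linealitySpace hI
  rw [InitialDegeneration.configOfIdeal]
  constructor
  · exact InitialDegeneration.exists_isSubfan_secondaryFan h1 fun w hw v h =>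
      InitialDegeneration.mem_lowerExact_of_refines h1 hw h
  -- The reflected set `-Ω*(I)` is closed under coarsening; reflecting its subfan back gives the
  -- claim.
  · obtain ⟨G, hG, hsupp⟩ := InitialDegeneration.exists_isSubfan_secondaryFan h1
      (Ω := -InitialDegeneration.upperExact I) fun w hw v h =>
        Set.mem_neg.2 (InitialDegeneration.mem_upperExact_of_refines (w := -w) (v := -v) h1
          (Set.mem_neg.1 hw) (by rwa [neg_neg, neg_neg]))
    exact ⟨_, hG.neg, by rw [InitialDegeneration.support_negFan, hsupp, neg_neg]⟩
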